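/- Let $d\ge 1$. For a real-valued $\Phi\in C^\infty(\mathbf R^d)$, a complex-valued $b\in C_0^\infty(\mathbf R^d)$ with support $K=\operatorname{supp} b$, and an open neighbourhood $V$ of $K$, put $$\mathcal M_k=\sum_{2\le|\alpha|\le k}\ \sup_{\xi\in V}|D^\alpha_\xi\Phi(\xi)|,\qquad \mathcal N_l=\sum_{|\alpha|\le l}\ \sup_{\xi\in K}|D_\xi^\alpha b(\xi)|,\qquad I(\lambda)=\int_{\mathbf R^d}e^{i\lambda\Phi(\xi)}\,b(\xi)\,d\xi .$$ **Theorem.** For every $v\ge 0$ there is a constant $C$, depending only on $d$ and $v$, such that the following holds. Let $\Phi$, $b$, $K$, $V$ be as above, suppose that $K$ has Lebesgue measure at most $v$, and let $a_0>0$. Assume that 1. $\mathcal M_k<+\infty$ for $2\le k\le d+2$; 2. $\mathcal N_l<+\infty$ for $l\le d+1$; 3. $|\det\operatorname{Hess}\Phi(\xi)|\ge a_0$ for all $\xi\in V$, where $\operatorname{Hess}\Phi$ is the Hessian matrix of $\Phi$. Then, for all $\lambda\ge1$, $$|I(\lambda)|\le\frac{C}{a_0^{1+d}}\Big(1+\mathcal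 M_{d+2}^{\frac d2+d^2}\Big)\,\mathcal N_{d+1}\,\lambda^{-\frac d2}.$$ In particular $C$ does not depend on $\Phi$, $V$, $a_0$ or $\lambda$, and it depends on $b$ only through the upper bound $v$ for the measure of its support; no bound on $\nabla\Phi$ and no information on critical points is assumed. -/

import Mathlib

open scoped ENNReal NNReal ContDiff

noncomputable section

namespace StationaryPhase

/-- The partial derivative `∂ f / ∂ ξ_i` on `ℝ^d`. -/
def partialDeriv {d : ℕ} {F : Type*} [NormedAddCommGroup F] [NormedSpace ℝ F] (i : Fin d)
    (f : EuclideanSpace ℝ (Fin d) → F) : EuclideanSpace ℝ (Fin d) → F :=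
  fun ξ => fderiv ℝ f ξ (EuclideanSpace.single i 1)

/-- The derivative `D^α f = ∂_0^{α_0} ⋯ ∂_{d-1}^{α_{d-1}} f` for a multi-index `α`. -/
def multiDeriv {d : ℕ} {F : Type*} [NormedAddCommGroup F] [NormedSpace ℝ F] (α : Fin d → ℕ)
    (f : EuclideanSpace ℝ (Fin d) → F) : EuclideanSpace ℝ (Fin d) → F :=
  (List.finRange d).foldr (fun i g => (partialDeriv i)^[α i] g) f

/-- `∑_{m ≤ |α| ≤ k} sup_{ξ ∈ S} |D^α f(ξ)|`, a number in `[0, ∞]`. The finset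
`Finset.piAntidiag Finset.univ n` is the set of multi-indices `α` with `|α| = n`. -/
def derivSum {d : ℕ} {F : Type*} [NormedAddCommGroup F] [NormedSpace ℝ F] (m k : ℕ)
    (S : Set (EuclideanSpace ℝ (Fin d))) (f : EuclideanSpace ℝ (Fin d) → F) : ℝ≥0∞ :=
  ∑ n ∈ Finset.Icc m k, ∑ α ∈ Finset.piAntidiag (Finset.univ : Finset (Fin d)) n,
    ⨆ ξ ∈ S, ‖multiDeriv α f ξ‖ₑ

/-- `M_k = ∑_{2 ≤ |α| ≤ k} sup_{ξ ∈ V} |D^α Φ(ξ)|`. -/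
def phaseBound {d : ℕ} (k : ℕ) (V : Set (EuclideanSpace ℝ (Fin d)))
    (Φ : EuclideanSpace ℝ (Fin d) → ℝ) : ℝ≥0∞ :=
  derivSum 2 k V Φ

/-- `N_l = ∑_{|α| ≤ l} sup_{ξ ∈ supp b} |D^α b(ξ)|`. -/
def symbolBound {d : ℕ} (l : ℕ) (b : EuclideanSpace ℝ (Fin d) → ℂ) : ℝ≥0∞ :=
  derivSum 0 l (tsupport b) b

/-- The Hessian matrix `(∂_i ∂_j Φ(ξ))_{i,j}`. -/
def hess {d : ℕ} (Φ : EuclideanSpace ℝ (Fin d) → ℝ) (ξ : EuclideanSpace ℝ (Fin d)) :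
    Matrix (Fin d) (Fin d) ℝ :=
  Matrix.of fun i j => partialDeriv i (partialDeriv j Φ) ξ

/-- The oscillatory integral `I(λ) = ∫ e^{iλΦ(ξ)} b(ξ) dξ`. -/
def oscIntegral {d : ℕ} (Φ : EuclideanSpace ℝ (Fin d) → ℝ)
    (b : EuclideanSpace ℝ (Fin d) → ℂ) (lam : ℝ) : ℂ :=
  ∫ ξ, Complex.exp (Complex.I * (lam : ℂ) * (Φ ξ : ℂ)) * b ξ

end StationaryPhase

end

namespace StationaryPhase

section DerivativeNorms

variable {d : ℕ} {F : Type*} [NormedAddCommGroup F] [NormedSpace ℝ F]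

theorem contDiff_partialDeriv {f : EuclideanSpace ℝ (Fin d) → F} (hf : ContDiff ℝ ∞ f)
    (i : Fin d) : ContDiff ℝ ∞ (partialDeriv i f) :=
  (hf.fderiv_right (m := ∞) (by simp)).clm_apply contDiff_const

theorem partialDeriv_comm {f : EuclideanSpace ℝ (Fin d) → F} (hf : ContDiff ℝ ∞ f)
    (i j : Fin d) : partialDeriv i (partialDeriv j f) = partialDeriv j (partialDeriv i f) := by
  have hd : Differentiable ℝ (fderiv ℝ f) :=
    (hf.fderiv_right (m := 1) (by norm_cast)).differentiable (by simp)
  have key : ∀ (i j : Fin d) (x : EuclideanSpace ℝ (Fin d)),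
      partialDeriv i (partialDeriv j f) x =
        fderiv ℝ (fderiv ℝ f) x (EuclideanSpace.single i 1) (EuclideanSpace.single j 1) := by
    intro i j x
    unfold partialDeriv
    rw [fderiv_clm_apply (hd x) (differentiableAt_const _)]
    simp
  funext x
  rw [key, key]
  have h2 : minSmoothness ℝ 2 ≤ (∞ : WithTop ℕ∞) := by
    rw [minSmoothness_of_isRCLikeNormedField]
    exact WithTop.coe_le_coe.2 (le_top (a := (2 : ℕ∞)))
  exact (hf.contDiffAt.isSymmSndFDerivAt h2).eq _ _

/-- The iterated partial derivative along a list of coordinates. -/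
noncomputable def listDeriv (l : List (Fin d)) (f : EuclideanSpace ℝ (Fin d) → F) :
    EuclideanSpace ℝ (Fin d) → F :=
  l.foldr partialDeriv f

theorem contDiff_listDeriv {f : EuclideanSpace ℝ (Fin d) → F} (hf : ContDiff ℝ ∞ f)
    (l : List (Fin d)) : ContDiff ℝ ∞ (listDeriv l f) := by
  induction l with
  | nil => exact hf
  | cons i l ih => exact contDiff_partialDeriv ih i

theorem listDeriv_perm {f : EuclideanSpace ℝ (Fin d) → F} (hf : ContDiff ℝ ∞ f)
    {l₁ l₂ : List (Fin d)} (h : l₁.Perm l₂) : listDeriv l₁ f = listDeriv l₂ f := by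
  induction h with
  | nil => rfl
  | cons i _ ih => exact congrArg (partialDeriv i) ih
  | swap i j l => exact partialDeriv_comm (contDiff_listDeriv hf l) j i
  | trans _ _ h₁ h₂ => exact h₁.trans h₂

theorem listDeriv_append (l₁ l₂ : List (Fin d)) (f : EuclideanSpace ℝ (Fin d) → F) :
    listDeriv (l₁ ++ l₂) f = listDeriv l₁ (listDeriv l₂ f) :=
  List.foldr_append

theorem listDeriv_replicate (n : ℕ) (i : Fin d) (f : EuclideanSpace ℝ (Fin d) → F) :
    listDeriv (List.replicate n i) f = (partialDeriv i)^[n] f := by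
  induction n with
  | zero => rfl
  | succ n ih =>
    rw [Function.iterate_succ_apply', ← ih]
    rfl

theorem multiDeriv_eq_listDeriv (α : Fin d → ℕ) (f : EuclideanSpace ℝ (Fin d) → F) :
    multiDeriv α f =
      listDeriv ((List.finRange d).flatMap fun i => List.replicate (α i) i) f := by
  unfold multiDeriv
  induction List.finRange d with
  | nil => rfl
  | cons i l ih =>
    rw [List.foldr_cons, ih, List.flatMap_cons, listDeriv_append, listDeriv_replicate]

theorem listDeriv_eq_multiDeriv {f : EuclideanSpace ℝ (Fin d) → F} (hf : ContDiff ℝ ∞ f)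
    (l : List (Fin d)) : listDeriv l f = multiDeriv (fun i => l.count i) f := by
  rw [multiDeriv_eq_listDeriv]
  refine listDeriv_perm hf (List.perm_iff_count.2 fun i => ?_)
  rw [List.count_flatMap]
  have : (List.map (List.count i ∘ fun j => List.replicate (List.count j l) j)
      (List.finRange d)).sum = ∑ j : Fin d, if j = i then l.count j else 0 := by
    rw [← List.ofFn_eq_map, List.sum_ofFn]
    refine Finset.sum_congr rfl fun j _ => ?_
    simp [List.count_replicate]
  rw [this]
  simp

theorem iteratedFDeriv_single_eq_listDeriv {f : EuclideanSpace ℝ (Fin d) → F}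
    (hf : ContDiff ℝ ∞ f) (n : ℕ) (s : Fin n → Fin d) (x : EuclideanSpace ℝ (Fin d)) :
    iteratedFDeriv ℝ n f x (fun k => EuclideanSpace.single (s k) 1) =
      listDeriv (List.ofFn s) f x := by
  induction n generalizing x with
  | zero => simp [listDeriv]
  | succ n ih =>
    have hd : DifferentiableAt ℝ (iteratedFDeriv ℝ n f) x :=
      (hf.differentiable_iteratedFDeriv (by exact_mod_cast WithTop.coe_lt_top _)) x
    rw [iteratedFDeriv_succ_apply_left, List.ofFn_succ]
    have : listDeriv (s 0 :: List.ofFn fun i => s i.succ) f x =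
        partialDeriv (s 0) (listDeriv (List.ofFn fun i => s i.succ) f) x := rfl
    rw [this]
    have h2 : listDeriv (List.ofFn fun i => s i.succ) f = fun y =>
        iteratedFDeriv ℝ n f y (fun k => EuclideanSpace.single (s k.succ) 1) :=
      funext fun y => (ih (fun k => s k.succ) y).symm
    rw [h2]
    unfold partialDeriv
    rw [fderiv_continuousMultilinear_apply_const_apply hd]
    rfl

theorem opNorm_le_sum_single {n : ℕ}
    (T : ContinuousMultilinearMap ℝ (fun _ : Fin n => EuclideanSpace ℝ (Fin d)) F) :
    ‖T‖ ≤ ∑ s : Fin n → Fin d, ‖T fun k => EuclideanSpace.single (s k) 1‖ := by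
  refine T.opNorm_le_bound (by positivity) fun m => ?_
  have hm : ∀ k, m k = ∑ i : Fin d, m k i • EuclideanSpace.single i (1 : ℝ) := by
    intro k
    ext j
    simp [Finset.sum_apply, Pi.single_apply]
  have : T m = ∑ s : Fin n → Fin d,
      (∏ k, m k (s k)) • T fun k => EuclideanSpace.single (s k) 1 := by
    conv_lhs => rw [show m = fun k => ∑ i : Fin d, m k i • EuclideanSpace.single i (1 : ℝ) from
      funext hm]
    rw [T.map_sum]
    exact Finset.sum_congr rfl fun s _ => T.map_smul_univ _ _
  rw [this, Finset.sum_mul]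
  refine (norm_sum_le _ _).trans (Finset.sum_le_sum fun s _ => ?_)
  rw [norm_smul, mul_comm, norm_prod]
  gcongr with k
  exact PiLp.norm_apply_le (m k) (s k)

theorem norm_iteratedFDeriv_le_derivSum {f : EuclideanSpace ℝ (Fin d) → F}
    (hf : ContDiff ℝ ∞ f) {m k n : ℕ} (hm : m ≤ n) (hk : n ≤ k)
    {S : Set (EuclideanSpace ℝ (Fin d))} (hS : derivSum m k S f < ⊤)
    {x : EuclideanSpace ℝ (Fin d)} (hx : x ∈ S) :
    ‖iteratedFDeriv ℝ n f x‖ ≤ (d : ℝ) ^ n * (derivSum m k S f).toReal := by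
  have key : ∀ s : Fin n → Fin d, ‖iteratedFDeriv ℝ n f x fun k => EuclideanSpace.single (s k) 1‖
      ≤ (derivSum m k S f).toReal := by
    intro s
    rw [iteratedFDeriv_single_eq_listDeriv hf, listDeriv_eq_multiDeriv hf]
    set α : Fin d → ℕ := fun i => (List.ofFn s).count i
    have hα : α ∈ Finset.piAntidiag (Finset.univ : Finset (Fin d)) n := by
      rw [Finset.mem_piAntidiag]
      refine ⟨?_, fun i _ => Finset.mem_univ i⟩
      have := Multiset.sum_count_eq_card (s := Finset.univ) (m := (List.ofFn s : Multiset (Fin d)))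
        (fun a _ => Finset.mem_univ a)
      simpa [α] using this
    have h1 : ‖multiDeriv α f x‖ₑ ≤ derivSum m k S f := by
      refine (le_iSup₂ (f := fun ξ (_ : ξ ∈ S) => ‖multiDeriv α f ξ‖ₑ) x hx).trans ?_
      unfold derivSum
      refine le_trans ?_ (Finset.single_le_sum (fun _ _ => zero_le) (Finset.mem_Icc.2 ⟨hm, hk⟩))
      exact Finset.single_le_sum (f := fun α => ⨆ ξ ∈ S, ‖multiDeriv α f ξ‖ₑ)
        (fun _ _ => zero_le) hα
    have := ENNReal.toReal_mono hS.ne h1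
    simpa using this
  refine (opNorm_le_sum_single _).trans ((Finset.sum_le_sum fun s _ => key s).trans ?_)
  simp

end DerivativeNorms

section SymbolCalculus

variable {E F : Type*} [NormedAddCommGroup E] [NormedSpace ℝ E] [NormedAddCommGroup F]
  [NormedSpace ℝ F]

/-- The derivatives of `f` of order `j ≤ n` at `x` have norm at most `A * h ^ (-j)`. -/
def ScaledBound (h : ℝ) (n : ℕ) (A : ℝ) (f : E → F) (x : E) : Prop :=
  ∀ j ≤ n, h ^ j * ‖iteratedFDeriv ℝ j f x‖ ≤ A

theorem natCast_le_infty (n : ℕ) : (n : WithTop ℕ∞) ≤ (∞ : WithTop ℕ∞) := by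
  exact WithTop.coe_le_coe.2 le_top

variable {h A B : ℝ} {n : ℕ} {x : E}

theorem ScaledBound.mono {f : E → F} (hf : ScaledBound h n A f x) {m : ℕ} (hm : m ≤ n)
    (hAB : A ≤ B) : ScaledBound h m B f x :=
  fun j hj => (hf j (hj.trans hm)).trans hAB

theorem ScaledBound.nonneg {f : E → F} (hf : ScaledBound h n A f x) : 0 ≤ A := by
  have := hf 0 (Nat.zero_le _)
  rw [pow_zero, one_mul] at this
  exact (norm_nonneg _).trans this

theorem ScaledBound.norm_le {f : E → F} (hf : ScaledBound h n A f x) : ‖f x‖ ≤ A := by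
  simpa using hf 0 (Nat.zero_le _)

theorem ScaledBound.add {f g : E → F} (hfc : ContDiff ℝ ∞ f) (hgc : ContDiff ℝ ∞ g)
    (hh : 0 ≤ h) (hf : ScaledBound h n A f x) (hg : ScaledBound h n B g x) :
    ScaledBound h n (A + B) (fun y => f y + g y) x := by
  intro j hj
  rw [fun_iteratedFDeriv_add_apply (hfc.contDiffAt.of_le (natCast_le_infty j))
    (hgc.contDiffAt.of_le (natCast_le_infty j))]
  calc h ^ j * ‖iteratedFDeriv ℝ j f x + iteratedFDeriv ℝ j g x‖
      ≤ h ^ j * (‖iteratedFDeriv ℝ j f x‖ + ‖iteratedFDeriv ℝ j g x‖) := by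
        gcongr; exact norm_add_le _ _
    _ ≤ A + B := by rw [mul_add]; exact add_le_add (hf j hj) (hg j hj)

theorem ScaledBound.sum {ι : Type*} [Fintype ι] {f : ι → E → F}
    (hfc : ∀ i, ContDiff ℝ ∞ (f i)) (hh : 0 ≤ h) (hf : ∀ i, ScaledBound h n A (f i) x) :
    ScaledBound h n (Fintype.card ι * A) (fun y => ∑ i, f i y) x := by
  intro j hj
  rw [iteratedFDeriv_fun_sum_apply
    (fun i _ => (hfc i).contDiffAt.of_le (natCast_le_infty j))]
  calc h ^ j * ‖∑ i, iteratedFDeriv ℝ j (f i) x‖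
      ≤ h ^ j * ∑ i, ‖iteratedFDeriv ℝ j (f i) x‖ := by
        gcongr; exact norm_sum_le _ _
    _ ≤ ∑ _i : ι, A := by rw [Finset.mul_sum]; exact Finset.sum_le_sum fun i _ => hf i j hj
    _ = _ := by simp

theorem ScaledBound.smul {f : E → ℝ} {g : E → F}
    (hfc : ContDiff ℝ ∞ f) (hgc : ContDiff ℝ ∞ g)
    (hh : 0 ≤ h) (hf : ScaledBound h n A f x) (hg : ScaledBound h n B g x) :
    ScaledBound h n (2 ^ n * A * B) (fun y => f y • g y) x := by
  have hA := hf.nonneg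
  have hB := hg.nonneg
  intro j hj
  calc h ^ j * ‖iteratedFDeriv ℝ j (fun y => f y • g y) x‖
      ≤ h ^ j * ∑ i ∈ Finset.range (j + 1),
        (j.choose i : ℝ) * ‖iteratedFDeriv ℝ i f x‖ * ‖iteratedFDeriv ℝ (j - i) g x‖ := by
        gcongr; exact norm_iteratedFDeriv_smul_le hfc hgc x (natCast_le_infty j)
    _ = ∑ i ∈ Finset.range (j + 1), (j.choose i : ℝ) * ((h ^ i * ‖iteratedFDeriv ℝ i f x‖) *
          (h ^ (j - i) * ‖iteratedFDeriv ℝ (j - i) g x‖)) := by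
        rw [Finset.mul_sum]
        refine Finset.sum_congr rfl fun i hi => ?_
        rw [← pow_mul_pow_sub h (Nat.lt_succ_iff.1 (Finset.mem_range.1 hi))]
        ring
    _ ≤ ∑ i ∈ Finset.range (j + 1), (j.choose i : ℝ) * (A * B) := by
        refine Finset.sum_le_sum fun i hi => ?_
        have hij := Nat.lt_succ_iff.1 (Finset.mem_range.1 hi)
        gcongr
        · exact hf i (hij.trans hj)
        · exact hg (j - i) ((Nat.sub_le _ _).trans hj)
    _ = 2 ^ j * A * B := by
        rw [← Finset.sum_mul, ← Nat.cast_sum, Nat.sum_range_choose]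
        push_cast
        ring
    _ ≤ 2 ^ n * A * B := by gcongr; norm_num

theorem ScaledBound.fderiv {f : E → F} (hh : 0 ≤ h) (hf : ScaledBound h (n + 1) A f x)
    (hfc : ContDiff ℝ ∞ f) : ScaledBound h n A (fun y => h • fderiv ℝ f y) x := by
  intro j hj
  have hc : ContDiff ℝ ∞ (_root_.fderiv ℝ f) := hfc.fderiv_right (by simp)
  rw [iteratedFDeriv_const_smul_apply' (hc.contDiffAt.of_le (natCast_le_infty j)), norm_smul,
    norm_iteratedFDeriv_fderiv, Real.norm_of_nonneg hh, ← mul_assoc, ← pow_succ]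
  exact hf (j + 1) (by omega)

theorem pow_mul_norm_iteratedFDeriv_fderiv_apply_le {f : E → F} (hh : 0 ≤ h)
    (hfc : ContDiff ℝ ∞ f) {e : E} (he : ‖e‖ ≤ 1) (j : ℕ) :
    h ^ j * ‖iteratedFDeriv ℝ j (fun y => h • fderiv ℝ f y e) x‖ ≤
      h ^ (j + 1) * ‖iteratedFDeriv ℝ (j + 1) f x‖ := by
  have hc : ContDiff ℝ ∞ (fun y => h • fderiv ℝ f y) :=
    (hfc.fderiv_right (m := ∞) (by simp)).const_smul h
  have hc' : ContDiff ℝ ∞ (_root_.fderiv ℝ f) := hfc.fderiv_right (by simp)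
  calc _ ≤ h ^ j * ‖iteratedFDeriv ℝ j (fun y => h • fderiv ℝ f y) x‖ := by
        gcongr
        refine (norm_iteratedFDeriv_clm_apply_const (c := e)
          (f := fun y => h • fderiv ℝ f y) hc.contDiffAt (natCast_le_infty j)).trans ?_
        exact mul_le_of_le_one_left (norm_nonneg _) he
    _ = _ := by
        rw [iteratedFDeriv_const_smul_apply' (hc'.contDiffAt.of_le (natCast_le_infty j)),
          norm_smul, norm_iteratedFDeriv_fderiv, Real.norm_of_nonneg hh, ← mul_assoc, ← pow_succ]

theorem ScaledBound.fderiv_apply {f : E → F} (hh : 0 ≤ h) (hf : ScaledBound h (n + 1) A f x)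
    (hfc : ContDiff ℝ ∞ f) {e : E} (he : ‖e‖ ≤ 1) :
    ScaledBound h n A (fun y => h • _root_.fderiv ℝ f y e) x :=
  fun j hj => (pow_mul_norm_iteratedFDeriv_fderiv_apply_le hh hfc he j).trans
    (hf (j + 1) (by omega))

theorem ScaledBound.succ {f : E → F} (hh : 0 ≤ h) (hf : ‖f x‖ ≤ A) (hfc : ContDiff ℝ ∞ f)
    (hf' : ScaledBound h n A (fun y => h • _root_.fderiv ℝ f y) x) :
    ScaledBound h (n + 1) A f x := by
  intro j hj
  cases j with
  | zero => simpa using hf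
  | succ j =>
    have := hf' j (by omega)
    have hc : ContDiff ℝ ∞ (_root_.fderiv ℝ f) := hfc.fderiv_right (by simp)
    rwa [iteratedFDeriv_const_smul_apply' (hc.contDiffAt.of_le (natCast_le_infty j)), norm_smul,
      norm_iteratedFDeriv_fderiv, Real.norm_of_nonneg hh, ← mul_assoc, ← pow_succ] at this

theorem scaledBound_const (c : F) : ScaledBound h n ‖c‖ (fun _ : E => c) x := by
  intro j _
  cases j with
  | zero => simp
  | succ j => simp [iteratedFDeriv_const_of_ne (Nat.succ_ne_zero j)]

/-- The constant in the bound for the derivatives of `1 / p` in terms of those of `p`. -/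
def invConst (A : ℝ) : ℕ → ℝ
  | 0 => 1
  | n + 1 => max (invConst A n) (2 ^ n * (2 ^ n * invConst A n * invConst A n) * A)

theorem one_le_invConst (A : ℝ) (n : ℕ) : 1 ≤ invConst A n := by
  induction n with
  | zero => exact le_rfl
  | succ n ih => exact ih.trans (le_max_left _ _)

theorem ScaledBound.inv {p : E → ℝ} (hpc : ContDiff ℝ ∞ p) (hp : ∀ y, 0 < p y) (hh : 0 ≤ h)
    (hb : ScaledBound h n (A * p x) p x) :
    ScaledBound h n (invConst A n * (p x)⁻¹) (fun y => (p y)⁻¹) x := by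
  have hpx := hp x
  have hic : ContDiff ℝ ∞ (fun y => (p y)⁻¹) := hpc.inv fun y => (hp y).ne'
  induction n with
  | zero =>
    intro j hj
    obtain rfl : j = 0 := by omega
    simp [invConst, abs_of_pos hpx]
  | succ n ih =>
    have ih := ih (hb.mono (Nat.le_succ n) le_rfl)
    have hx : ‖(p x)⁻¹‖ ≤ invConst A (n + 1) * (p x)⁻¹ :=
      ih.norm_le.trans (mul_le_mul_of_nonneg_right (le_max_left _ _) (by positivity))
    refine ScaledBound.succ hh hx hic ?_
    have hder : (fun y => h • _root_.fderiv ℝ (fun y => (p y)⁻¹) y) =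
        fun y => ((p y)⁻¹ • (p y)⁻¹) • (-(h • _root_.fderiv ℝ p y)) := by
      funext y
      have := (hasDerivAt_inv (hp y).ne').comp_hasFDerivAt y
        ((hpc.differentiable (by simp)) y).hasFDerivAt
      rw [show (fun y => (p y)⁻¹) = Inv.inv ∘ p from rfl, this.fderiv]
      ext v
      simp
      ring
    rw [hder]
    have hdc : ContDiff ℝ ∞ (fun y => h • _root_.fderiv ℝ p y) :=
      (hpc.fderiv_right (m := ∞) (by simp)).const_smul h
    have hneg : ScaledBound h n (A * p x) (fun y => -(h • _root_.fderiv ℝ p y)) x := by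
      intro j hj
      rw [show (fun y => -(h • _root_.fderiv ℝ p y)) = -(fun y => h • _root_.fderiv ℝ p y) from rfl,
        iteratedFDeriv_neg_apply, norm_neg]
      exact hb.fderiv hh hpc j hj
    refine ((ih.smul hic hic hh ih).smul (hic.smul hic) hdc.neg hh hneg).mono le_rfl ?_
    calc _ = 2 ^ n * (2 ^ n * invConst A n * invConst A n) * A * (p x)⁻¹ := by
          field_simp
      _ ≤ _ := mul_le_mul_of_nonneg_right (le_max_right _ _) (by positivity)

end SymbolCalculus

section NonstationaryPhase

variable {d : ℕ}

/-- The rescaled partial derivative `h ∂_m θ`. -/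
noncomputable def rescaledPartial (h : ℝ) (θ : EuclideanSpace ℝ (Fin d) → ℝ) (m : Fin d) :
    EuclideanSpace ℝ (Fin d) → ℝ :=
  fun x => h • partialDeriv m θ x

/-- The weight `1 + h² |∇θ|²`. -/
noncomputable def gradWeight (h : ℝ) (θ : EuclideanSpace ℝ (Fin d) → ℝ) :
    EuclideanSpace ℝ (Fin d) → ℝ :=
  fun x => 1 + ∑ m, rescaledPartial h θ m x • rescaledPartial h θ m x

/-- The transpose of `(1 + h² |∇θ|²)⁻¹ (1 - i h² ∇θ · ∇)`, an operator which fixes `e^{iθ}`. -/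
noncomputable def transposeOp (h : ℝ) (θ : EuclideanSpace ℝ (Fin d) → ℝ)
    (g : EuclideanSpace ℝ (Fin d) → ℂ) : EuclideanSpace ℝ (Fin d) → ℂ :=
  fun x => (gradWeight h θ x)⁻¹ • g x +
    ∑ m, h • partialDeriv m (fun y => (rescaledPartial h θ m y • (gradWeight h θ y)⁻¹) •
      (Complex.I • g y)) x

variable {h : ℝ} {θ : EuclideanSpace ℝ (Fin d) → ℝ} {g : EuclideanSpace ℝ (Fin d) → ℂ}

theorem one_le_gradWeight (h : ℝ) (θ : EuclideanSpace ℝ (Fin d) → ℝ)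
    (x : EuclideanSpace ℝ (Fin d)) : 1 ≤ gradWeight h θ x :=
  le_add_of_nonneg_right (Finset.sum_nonneg fun _ _ => mul_self_nonneg _)

theorem gradWeight_pos (h : ℝ) (θ : EuclideanSpace ℝ (Fin d) → ℝ)
    (x : EuclideanSpace ℝ (Fin d)) : 0 < gradWeight h θ x :=
  zero_lt_one.trans_le (one_le_gradWeight h θ x)

theorem contDiff_rescaledPartial (hθ : ContDiff ℝ ∞ θ) (m : Fin d) :
    ContDiff ℝ ∞ (rescaledPartial h θ m) :=
  (contDiff_partialDeriv hθ m).const_smul h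

theorem contDiff_gradWeight (hθ : ContDiff ℝ ∞ θ) : ContDiff ℝ ∞ (gradWeight h θ) :=
  contDiff_const.add (ContDiff.sum fun m _ =>
    (contDiff_rescaledPartial hθ m).smul (contDiff_rescaledPartial hθ m))

theorem contDiff_inv_gradWeight (hθ : ContDiff ℝ ∞ θ) :
    ContDiff ℝ ∞ (fun y => (gradWeight h θ y)⁻¹) :=
  (contDiff_gradWeight hθ).inv fun y => (gradWeight_pos h θ y).ne'

theorem contDiff_flux (hθ : ContDiff ℝ ∞ θ) (hg : ContDiff ℝ ∞ g) (m : Fin d) :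
    ContDiff ℝ ∞ (fun y => (rescaledPartial h θ m y • (gradWeight h θ y)⁻¹) •
      (Complex.I • g y)) :=
  ((contDiff_rescaledPartial hθ m).smul (contDiff_inv_gradWeight hθ)).smul
    (hg.const_smul Complex.I)

theorem contDiff_transposeOp (hθ : ContDiff ℝ ∞ θ) (hg : ContDiff ℝ ∞ g) :
    ContDiff ℝ ∞ (transposeOp h θ g) :=
  ((contDiff_inv_gradWeight hθ).smul hg).add (ContDiff.sum fun m _ =>
    (contDiff_partialDeriv (contDiff_flux hθ hg m) m).const_smul h)

theorem tsupport_transposeOp_subset : tsupport (transposeOp h θ g) ⊆ tsupport g := by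
  refine closure_minimal (fun x hx => ?_) (isClosed_tsupport g)
  by_contra hxg
  refine hx ?_
  have h0 : g =ᶠ[nhds x] 0 := notMem_tsupport_iff_eventuallyEq.1 hxg
  have h1 : ∀ m, partialDeriv m (fun y => (rescaledPartial h θ m y • (gradWeight h θ y)⁻¹) •
      (Complex.I • g y)) x = 0 := by
    intro m
    have : (fun y => (rescaledPartial h θ m y • (gradWeight h θ y)⁻¹) •
      (Complex.I • g y)) =ᶠ[nhds x] fun _ => 0 := by
      filter_upwards [h0] with y hy
      simp [hy]
    unfold partialDeriv
    rw [this.fderiv_eq]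
    simp
  simp only [transposeOp, h1, h0.eq_of_nhds]
  simp

theorem scaledBound_rescaledPartial (hθ : ContDiff ℝ ∞ θ) (hh : 0 ≤ h)
    {x : EuclideanSpace ℝ (Fin d)} {n : ℕ}
    (hb : ∀ j, 2 ≤ j → j ≤ n + 1 → h ^ j * ‖iteratedFDeriv ℝ j θ x‖ ≤ 1) (m : Fin d) :
    ScaledBound h n √(gradWeight h θ x) (rescaledPartial h θ m) x := by
  intro j hj
  rcases Nat.eq_zero_or_pos j with rfl | hj0
  · rw [pow_zero, one_mul, norm_iteratedFDeriv_zero]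
    refine Real.abs_le_sqrt ?_
    have := Finset.single_le_sum
      (f := fun m => rescaledPartial h θ m x • rescaledPartial h θ m x)
      (fun i _ => mul_self_nonneg _) (Finset.mem_univ m)
    rw [sq]
    exact this.trans (le_add_of_nonneg_left zero_le_one)
  · refine (pow_mul_norm_iteratedFDeriv_fderiv_apply_le hh hθ (by simp) j).trans ?_
    refine (hb (j + 1) (by omega) (by omega)).trans ?_
    exact Real.one_le_sqrt.2 (one_le_gradWeight h θ x)

theorem scaledBound_inv_gradWeight (hθ : ContDiff ℝ ∞ θ) (hh : 0 ≤ h)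
    {x : EuclideanSpace ℝ (Fin d)} {n : ℕ}
    (hb : ∀ j, 2 ≤ j → j ≤ n + 1 → h ^ j * ‖iteratedFDeriv ℝ j θ x‖ ≤ 1) :
    ScaledBound h n (invConst (1 + d * 2 ^ n) n * (gradWeight h θ x)⁻¹)
      (fun y => (gradWeight h θ y)⁻¹) x := by
  refine ScaledBound.inv (contDiff_gradWeight hθ) (gradWeight_pos h θ) hh ?_
  have hf := scaledBound_rescaledPartial hθ hh hb
  have hc := fun m => contDiff_rescaledPartial (h := h) hθ m
  have h1 := (scaledBound_const (h := h) (n := n) (x := x) (1 : ℝ)).add contDiff_const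
    (ContDiff.sum fun m _ => (hc m).smul (hc m)) hh
    (ScaledBound.sum (fun m => (hc m).smul (hc m)) hh
      fun m => (hf m).smul (hc m) (hc m) hh (hf m))
  refine h1.mono le_rfl ?_
  rw [norm_one, Fintype.card_fin, mul_assoc (2 ^ n), Real.mul_self_sqrt (gradWeight_pos h θ x).le]
  have := one_le_gradWeight h θ x
  linarith

/-- The constant in the bound for `transposeOp`. -/
noncomputable def transposeConst (d n : ℕ) : ℝ :=
  (1 + d) * (2 ^ n * (2 ^ n * invConst (1 + d * 2 ^ n) n))

theorem transposeConst_nonneg (d n : ℕ) : 0 ≤ transposeConst d n := by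
  have := one_le_invConst (1 + d * 2 ^ n) n
  unfold transposeConst
  positivity

theorem scaledBound_transposeOp (hθ : ContDiff ℝ ∞ θ) (hg : ContDiff ℝ ∞ g) (hh : 0 ≤ h)
    {x : EuclideanSpace ℝ (Fin d)} {n k : ℕ} (hk : k + 1 ≤ n)
    (hb : ∀ j, 2 ≤ j → j ≤ n + 1 → h ^ j * ‖iteratedFDeriv ℝ j θ x‖ ≤ 1) {A : ℝ}
    (hA : ScaledBound h (k + 1) A g x) :
    ScaledBound h k (transposeConst d n * (√(gradWeight h θ x))⁻¹ * A)
      (transposeOp h θ g) x := by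
  have hA0 := hA.nonneg
  have hp := gradWeight_pos h θ x
  set p := gradWeight h θ x with hpdef
  set K := invConst (1 + d * 2 ^ n) n with hK
  have hK1 : 1 ≤ K := one_le_invConst _ _
  have hinv : ScaledBound h n (K * p⁻¹) _ x := scaledBound_inv_gradWeight hθ hh hb
  have hic := contDiff_inv_gradWeight (h := h) hθ
  have hsq : √p * p⁻¹ = (√p)⁻¹ := by
    rw [← Real.mul_self_sqrt hp.le, Real.sqrt_mul_self (Real.sqrt_nonneg p)]
    have := (Real.sqrt_pos.2 hp).ne'
    field_simp
  have hpinv : p⁻¹ ≤ (√p)⁻¹ := by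
    rw [← hsq]
    exact le_mul_of_one_le_left (by positivity) (Real.one_le_sqrt.2 (one_le_gradWeight h θ x))
  have hI : ScaledBound h (k + 1) A (fun y => Complex.I • g y) x := by
    intro j hj
    rw [iteratedFDeriv_const_smul_apply' (hg.contDiffAt.of_le (natCast_le_infty j)), norm_smul,
      Complex.norm_I, one_mul]
    exact hA j hj
  have hflux : ∀ m, ScaledBound h (k + 1) (2 ^ n * (2 ^ n * K) * (√p)⁻¹ * A)
      (fun y => (rescaledPartial h θ m y • (gradWeight h θ y)⁻¹) • (Complex.I • g y)) x := by
    intro m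
    have hc : ScaledBound h n (2 ^ n * K * (√p)⁻¹)
        (fun y => rescaledPartial h θ m y • (gradWeight h θ y)⁻¹) x := by
      refine ((scaledBound_rescaledPartial hθ hh hb m).smul (contDiff_rescaledPartial hθ m) hic hh
        hinv).mono le_rfl (le_of_eq ?_)
      rw [← hsq]
      ring
    refine ((hc.mono hk le_rfl).smul ((contDiff_rescaledPartial hθ m).smul hic)
      (hg.const_smul _) hh hI).mono le_rfl ?_
    calc _ ≤ 2 ^ n * (2 ^ n * K * (√p)⁻¹) * A := by gcongr; norm_num
      _ = _ := by ring
  have hfirst : ScaledBound h k (2 ^ n * (2 ^ n * K) * (√p)⁻¹ * A)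
      (fun y => (gradWeight h θ y)⁻¹ • g y) x := by
    refine ((hinv.mono (show k ≤ n by omega) le_rfl).smul hic hg hh
      (hA.mono (Nat.le_succ k) le_rfl)).mono le_rfl ?_
    calc 2 ^ k * (K * p⁻¹) * A ≤ 2 ^ n * (2 ^ n * K * (√p)⁻¹) * A := by
          gcongr
          · norm_num
          · omega
          · exact le_mul_of_one_le_left (by positivity) (one_le_pow₀ (by norm_num))
      _ = _ := by ring
  have hsum := ScaledBound.sum
    (fun m => (contDiff_partialDeriv (contDiff_flux (h := h) hθ hg m) m).const_smul h) hh
    (fun m => (hflux m).fderiv_apply hh (contDiff_flux hθ hg m)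
      (e := EuclideanSpace.single m 1) (by simp))
  refine (hfirst.add (hic.smul hg) (ContDiff.sum fun m _ =>
    (contDiff_partialDeriv (contDiff_flux (h := h) hθ hg m) m).const_smul h) hh hsum).mono
      le_rfl (le_of_eq ?_)
  rw [Fintype.card_fin, transposeConst]
  ring

theorem contDiff_exp_phase (hθ : ContDiff ℝ ∞ θ) :
    ContDiff ℝ ∞ (fun x => Complex.exp (Complex.I * θ x)) :=
  (contDiff_const.mul (Complex.ofRealCLM.contDiff.comp hθ)).cexp

theorem partialDeriv_exp_phase (hθ : ContDiff ℝ ∞ θ) (m : Fin d)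
    (x : EuclideanSpace ℝ (Fin d)) :
    fderiv ℝ (fun x => Complex.exp (Complex.I * θ x)) x (EuclideanSpace.single m 1) =
      Complex.exp (Complex.I * θ x) * (Complex.I * ((partialDeriv m θ x : ℝ) : ℂ)) := by
  have h1 : HasFDerivAt (fun x => Complex.I * (θ x : ℂ))
      (Complex.I • Complex.ofRealCLM.comp (fderiv ℝ θ x)) x :=
    (Complex.ofRealCLM.hasFDerivAt.comp x
      ((hθ.differentiable (by simp)) x).hasFDerivAt).const_mul Complex.I
  rw [h1.cexp.fderiv]
  simp [partialDeriv]

theorem integrable_mul_of_hasCompactSupport {u v : EuclideanSpace ℝ (Fin d) → ℂ}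
    (hu : Continuous u) (hv : Continuous v) (hs : HasCompactSupport v) :
    MeasureTheory.Integrable (fun x => u x * v x) :=
  (hu.mul hv).integrable_of_hasCompactSupport hs.mul_left

theorem continuous_exp_phase_mul_partialDeriv (hθ : ContDiff ℝ ∞ θ) (m : Fin d) :
    Continuous fun x => Complex.exp (Complex.I * θ x) *
      (Complex.I * ((partialDeriv m θ x : ℝ) : ℂ)) :=
  (contDiff_exp_phase hθ).continuous.mul (continuous_const.mul
    (Complex.continuous_ofReal.comp (contDiff_partialDeriv hθ m).continuous))

theorem integral_exp_mul_partialDeriv (hθ : ContDiff ℝ ∞ θ)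
    {c : EuclideanSpace ℝ (Fin d) → ℂ} (hc : ContDiff ℝ ∞ c) (hcs : HasCompactSupport c)
    (m : Fin d) :
    ∫ x, Complex.exp (Complex.I * θ x) * partialDeriv m c x =
      - ∫ x, (Complex.exp (Complex.I * θ x) * (Complex.I * ((partialDeriv m θ x : ℝ) : ℂ))) * c x := by
  have hec := contDiff_exp_phase hθ
  have h1 : HasCompactSupport (partialDeriv m c) :=
    hcs.fderiv_apply ℝ (EuclideanSpace.single m (1 : ℝ))
  have := integral_mul_fderiv_eq_neg_fderiv_mul_of_integrable
    (μ := MeasureTheory.volume) (f := fun x => Complex.exp (Complex.I * θ x)) (g := c)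
    (v := EuclideanSpace.single m (1 : ℝ))
    (by
      simp only [partialDeriv_exp_phase hθ]
      exact integrable_mul_of_hasCompactSupport (continuous_exp_phase_mul_partialDeriv hθ m)
        hc.continuous hcs)
    (integrable_mul_of_hasCompactSupport hec.continuous (contDiff_partialDeriv hc m).continuous h1)
    (integrable_mul_of_hasCompactSupport hec.continuous hc.continuous hcs)
    (fun x _ => hec.differentiable (by simp) x) (fun x _ => hc.differentiable (by simp) x)
  simp only [partialDeriv_exp_phase hθ] at this
  exact this

theorem exp_mul_sum_flux (e : ℂ) (x : EuclideanSpace ℝ (Fin d)) :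
    e * ((gradWeight h θ x)⁻¹ • g x) +
      ∑ m, -((h : ℂ) * ((e * (Complex.I * ((partialDeriv m θ x : ℝ) : ℂ))) *
        ((rescaledPartial h θ m x • (gradWeight h θ x)⁻¹) • (Complex.I • g x)))) = e * g x := by
  have hw : ((gradWeight h θ x : ℝ) : ℂ) ≠ 0 := by
    exact_mod_cast (gradWeight_pos h θ x).ne'
  have hs : ∑ m, -((h : ℂ) * ((e * (Complex.I * ((partialDeriv m θ x : ℝ) : ℂ))) *
      ((rescaledPartial h θ m x • (gradWeight h θ x)⁻¹) • (Complex.I • g x)))) =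
      ((gradWeight h θ x : ℂ) - 1) * (e * (gradWeight h θ x : ℂ)⁻¹ * g x) := by
    have : (gradWeight h θ x : ℂ) - 1 =
        ∑ m, ((rescaledPartial h θ m x : ℝ) : ℂ) * ((rescaledPartial h θ m x : ℝ) : ℂ) := by
      simp [gradWeight]
    rw [this, Finset.sum_mul]
    refine Finset.sum_congr rfl fun m _ => ?_
    simp only [rescaledPartial, smul_eq_mul, Complex.real_smul, Complex.ofReal_mul,
      Complex.ofReal_inv]
    linear_combination (-(h : ℂ) * e * ((partialDeriv m θ x : ℝ) : ℂ) *
      (h * ((partialDeriv m θ x : ℝ) : ℂ)) * (gradWeight h θ x : ℂ)⁻¹ * g x) * Complex.I_mul_I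
  rw [hs, Complex.real_smul, Complex.ofReal_inv]
  field_simp
  ring

theorem integral_exp_mul_add_sum_partialDeriv (hθ : ContDiff ℝ ∞ θ)
    {a : EuclideanSpace ℝ (Fin d) → ℂ} (ha : Continuous a) (has : HasCompactSupport a)
    {c : Fin d → EuclideanSpace ℝ (Fin d) → ℂ} (hc : ∀ m, ContDiff ℝ ∞ (c m))
    (hcs : ∀ m, HasCompactSupport (c m)) :
    ∫ x, Complex.exp (Complex.I * θ x) * (a x + ∑ m, h • partialDeriv m (c m) x) =
      ∫ x, (Complex.exp (Complex.I * θ x) * a x + ∑ m, -((h : ℂ) *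
        ((Complex.exp (Complex.I * θ x) * (Complex.I * ((partialDeriv m θ x : ℝ) : ℂ))) *
          c m x))) := by
  have hec := contDiff_exp_phase hθ
  have hT : ∀ x, Complex.exp (Complex.I * θ x) * (a x + ∑ m, h • partialDeriv m (c m) x) =
      Complex.exp (Complex.I * θ x) * a x +
        ∑ m, (h : ℂ) * (Complex.exp (Complex.I * θ x) * partialDeriv m (c m) x) := by
    intro x
    rw [mul_add, Finset.mul_sum]
    congr 1
    refine Finset.sum_congr rfl fun m _ => ?_
    rw [Complex.real_smul]
    ring
  have hfirst := integrable_mul_of_hasCompactSupport hec.continuous ha has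
  have hterm : ∀ m, MeasureTheory.Integrable fun x =>
      (h : ℂ) * (Complex.exp (Complex.I * θ x) * partialDeriv m (c m) x) := fun m =>
    (integrable_mul_of_hasCompactSupport hec.continuous
      (contDiff_partialDeriv (hc m) m).continuous
      ((hcs m).fderiv_apply ℝ (EuclideanSpace.single m (1 : ℝ)))).const_mul _
  have hterm' : ∀ m, MeasureTheory.Integrable fun x =>
      -((h : ℂ) * ((Complex.exp (Complex.I * θ x) *
        (Complex.I * ((partialDeriv m θ x : ℝ) : ℂ))) * c m x)) := fun m =>
    ((integrable_mul_of_hasCompactSupport (continuous_exp_phase_mul_partialDeriv hθ m)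
      (hc m).continuous (hcs m)).const_mul _).neg
  have hswap : ∀ m, ∫ x, (h : ℂ) * (Complex.exp (Complex.I * θ x) * partialDeriv m (c m) x) =
      ∫ x, -((h : ℂ) * ((Complex.exp (Complex.I * θ x) *
        (Complex.I * ((partialDeriv m θ x : ℝ) : ℂ))) * c m x)) := by
    intro m
    rw [MeasureTheory.integral_const_mul, integral_exp_mul_partialDeriv hθ (hc m) (hcs m),
      MeasureTheory.integral_neg, MeasureTheory.integral_const_mul, mul_neg]
  simp_rw [hT]
  rw [MeasureTheory.integral_add hfirst (MeasureTheory.integrable_finsetSum _ fun m _ => hterm m),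
    MeasureTheory.integral_finsetSum _ fun m _ => hterm m, Finset.sum_congr rfl fun m _ => hswap m,
    ← MeasureTheory.integral_finsetSum _ fun m _ => hterm' m,
    ← MeasureTheory.integral_add hfirst
      (MeasureTheory.integrable_finsetSum _ fun m _ => hterm' m)]

theorem integral_exp_mul_transposeOp (hθ : ContDiff ℝ ∞ θ) (hg : ContDiff ℝ ∞ g)
    (hgs : HasCompactSupport g) :
    ∫ x, Complex.exp (Complex.I * θ x) * transposeOp h θ g x =
      ∫ x, Complex.exp (Complex.I * θ x) * g x := by
  have hcs : ∀ m, HasCompactSupport (fun y =>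
      (rescaledPartial h θ m y • (gradWeight h θ y)⁻¹) • (Complex.I • g y)) := by
    refine fun m => hgs.mono fun y hy hz => hy ?_
    simp only [hz, smul_zero]
  have has : HasCompactSupport (fun y => (gradWeight h θ y)⁻¹ • g y) := by
    refine hgs.mono fun y hy hz => hy ?_
    simp only [hz, smul_zero]
  refine (integral_exp_mul_add_sum_partialDeriv (h := h) hθ
    ((contDiff_inv_gradWeight hθ).smul hg).continuous has (contDiff_flux hθ hg) hcs).trans ?_
  exact congrArg _ (funext fun x => exp_mul_sum_flux _ x)

theorem iterate_transposeOp (hθ : ContDiff ℝ ∞ θ) (hg : ContDiff ℝ ∞ g)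
    (hgs : HasCompactSupport g) (k : ℕ) :
    ContDiff ℝ ∞ ((transposeOp h θ)^[k] g) ∧ tsupport ((transposeOp h θ)^[k] g) ⊆ tsupport g ∧
      ∫ x, Complex.exp (Complex.I * θ x) * (transposeOp h θ)^[k] g x =
        ∫ x, Complex.exp (Complex.I * θ x) * g x := by
  induction k with
  | zero => exact ⟨hg, subset_rfl, rfl⟩
  | succ k ih =>
    obtain ⟨h1, h2, h3⟩ := ih
    rw [Function.iterate_succ_apply']
    refine ⟨contDiff_transposeOp hθ h1, tsupport_transposeOp_subset.trans h2, ?_⟩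
    rw [integral_exp_mul_transposeOp hθ h1 (hgs.of_isClosed_subset (isClosed_tsupport _) h2), h3]

theorem norm_iterate_transposeOp_le (hθ : ContDiff ℝ ∞ θ) (hg : ContDiff ℝ ∞ g)
    (hgs : HasCompactSupport g) (hh : 0 ≤ h) {x : EuclideanSpace ℝ (Fin d)} {n : ℕ}
    (hb : ∀ j, 2 ≤ j → j ≤ n + 1 → h ^ j * ‖iteratedFDeriv ℝ j θ x‖ ≤ 1) {A : ℝ}
    (hA : ScaledBound h n A g x) :
    ‖(transposeOp h θ)^[n] g x‖ ≤
      (transposeConst d n * (√(gradWeight h θ x))⁻¹) ^ n * A := by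
  have key : ∀ k ≤ n, ScaledBound h (n - k)
      ((transposeConst d n * (√(gradWeight h θ x))⁻¹) ^ k * A) ((transposeOp h θ)^[k] g) x := by
    intro k
    induction k with
    | zero => intro _; simpa using hA
    | succ k ih =>
      intro hk
      have h1 := ih (by omega)
      rw [show n - k = n - (k + 1) + 1 by omega] at h1
      rw [Function.iterate_succ_apply']
      refine (scaledBound_transposeOp hθ (iterate_transposeOp hθ hg hgs k).1 hh (by omega) hb
        h1).mono le_rfl (le_of_eq ?_)
      ring
  exact (key n le_rfl).norm_le

theorem norm_integral_exp_mul_le (hθ : ContDiff ℝ ∞ θ) (hg : ContDiff ℝ ∞ g)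
    (hgs : HasCompactSupport g) (hh : 0 ≤ h) (n : ℕ)
    (hb : ∀ x ∈ tsupport g, ∀ j, 2 ≤ j → j ≤ n + 1 → h ^ j * ‖iteratedFDeriv ℝ j θ x‖ ≤ 1)
    {A : EuclideanSpace ℝ (Fin d) → ℝ} (hA : ∀ x ∈ tsupport g, ScaledBound h n (A x) g x) :
    ENNReal.ofReal ‖∫ x, Complex.exp (Complex.I * θ x) * g x‖ ≤
      ∫⁻ x in tsupport g, ENNReal.ofReal
        ((transposeConst d n * (√(gradWeight h θ x))⁻¹) ^ n * A x) := by
  obtain ⟨h1, h2, h3⟩ := iterate_transposeOp (h := h) hθ hg hgs n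
  rw [← h3, ofReal_norm]
  refine (MeasureTheory.enorm_integral_le_lintegral_enorm _).trans ?_
  rw [← MeasureTheory.lintegral_indicator (isClosed_tsupport g).measurableSet]
  refine MeasureTheory.lintegral_mono fun x => ?_
  by_cases hx : x ∈ tsupport g
  · rw [Set.indicator_of_mem hx, ← ofReal_norm]
    refine ENNReal.ofReal_le_ofReal ?_
    rw [norm_mul, mul_comm Complex.I, Complex.norm_exp_ofReal_mul_I, one_mul]
    exact norm_iterate_transposeOp_le hθ hg hgs hh (hb x hx) (hA x hx)
  · have : (transposeOp h θ)^[n] g x = 0 := image_eq_zero_of_notMem_tsupport fun hx' => hx (h2 hx')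
    simp [this]

end NonstationaryPhase

section BoundaryDecay

variable {E F : Type*} [NormedAddCommGroup E] [NormedSpace ℝ E] [NormedAddCommGroup F]
  [NormedSpace ℝ F]

theorem norm_iteratedFDeriv_le_mul_dist_pow {f : E → F} (hf : ContDiff ℝ ∞ f) {n : ℕ} {N : ℝ}
    (hN : ∀ x, ‖iteratedFDeriv ℝ n f x‖ ≤ N) {y : E}
    (hy : ∀ j, iteratedFDeriv ℝ j f y = 0) {k : ℕ} (hk : k ≤ n) (x : E) :
    ‖iteratedFDeriv ℝ (n - k) f x‖ ≤ N * dist x y ^ k := by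
  induction k generalizing x with
  | zero => simpa using hN x
  | succ k ih =>
    have hN0 : 0 ≤ N := (norm_nonneg _).trans (hN x)
    have hd : Differentiable ℝ (iteratedFDeriv ℝ (n - (k + 1)) f) :=
      hf.differentiable_iteratedFDeriv (WithTop.coe_lt_coe.2 (WithTop.coe_lt_top _))
    have := (convex_closedBall y (dist x y)).norm_image_sub_le_of_norm_fderiv_le (𝕜 := ℝ)
      (f := iteratedFDeriv ℝ (n - (k + 1)) f) (C := N * dist x y ^ k)
      (fun z _ => hd z)
      (fun z hz => by
        rw [norm_fderiv_iteratedFDeriv, show n - (k + 1) + 1 = n - k by omega]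
        refine (ih (by omega) z).trans ?_
        gcongr
        exact Metric.mem_closedBall.1 hz)
      (x := y) (y := x) (Metric.mem_closedBall_self dist_nonneg) (Metric.mem_closedBall.2 le_rfl)
    rw [hy, sub_zero, ← dist_eq_norm] at this
    rw [pow_succ, ← mul_assoc]
    exact this

end BoundaryDecay

section Depth

variable {E : Type*} [NormedAddCommGroup E]

/-- The distance to the complement of `K`, truncated at `1`. -/
noncomputable def depth (K : Set E) (x : E) : ℝ :=
  min 1 (Metric.infDist x Kᶜ)

theorem depth_nonneg (K : Set E) (x : E) : 0 ≤ depth K x :=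
  le_min zero_le_one Metric.infDist_nonneg

theorem depth_le_one (K : Set E) (x : E) : depth K x ≤ 1 :=
  min_le_left _ _

theorem depth_of_notMem {K : Set E} {x : E} (hx : x ∉ K) : depth K x = 0 := by
  rw [depth, Metric.infDist_zero_of_mem (show x ∈ Kᶜ from hx)]
  simp

theorem depth_le_add_dist (K : Set E) (x y : E) : depth K x ≤ depth K y + dist x y := by
  have := Metric.infDist_le_infDist_add_dist (s := Kᶜ) (x := x) (y := y)
  have hd : 0 ≤ dist x y := dist_nonneg
  unfold depth
  rcases le_total 1 (Metric.infDist y Kᶜ) with h | h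
  · rw [min_eq_left h]
    exact (min_le_left _ _).trans (by linarith)
  · rw [min_eq_right h]
    exact (min_le_right _ _).trans this

theorem continuous_depth (K : Set E) : Continuous (depth K) :=
  continuous_const.min (Metric.continuous_infDist_pt _)

theorem ball_depth_subset (K : Set E) (x : E) : Metric.ball x (depth K x) ⊆ K := by
  intro y hy
  by_contra hyK
  have := depth_le_add_dist K x y
  rw [depth_of_notMem hyK, zero_add, dist_comm] at this
  exact absurd (Metric.mem_ball.1 hy) (not_lt.2 this)

open MeasureTheory in
theorem lintegral_measure_ball_mul_le [MeasurableSpace E] [BorelSpace E]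
    [SecondCountableTopology E] (μ : Measure E) [SFinite μ] {K : Set E}
    (hK : MeasurableSet K) {κ : ℝ} (hκ : κ ≤ 1 / 2) {f : E → ℝ≥0∞} (hf : Measurable f)
    {Q : ℝ≥0∞} (hQ : ∀ z ∈ K, ∫⁻ x in Metric.ball z (2 * κ * depth K z), f x ∂μ ≤ Q) :
    ∫⁻ x, μ (Metric.ball x (κ * depth K x)) * f x ∂μ ≤ Q * μ K := by
  set S : Set (E × E) := {q | dist q.2 q.1 < κ * depth K q.1} with hS
  have hSm : MeasurableSet S := by
    refine (isOpen_lt (continuous_snd.dist continuous_fst) ?_).measurableSet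
    exact continuous_const.mul ((continuous_depth K).comp continuous_fst)
  have hm : Measurable (S.indicator fun q => f q.1) := (hf.comp measurable_fst).indicator hSm
  have h1 : ∀ x, μ (Metric.ball x (κ * depth K x)) * f x =
      ∫⁻ z, S.indicator (fun q => f q.1) (x, z) ∂μ := by
    intro x
    have : (fun z => S.indicator (fun q => f q.1) (x, z)) =
        (Metric.ball x (κ * depth K x)).indicator fun _ => f x := by
      funext z
      simp only [Set.indicator, hS, Set.mem_ofPred_eq, Metric.mem_ball]
    rw [this, lintegral_indicator Metric.isOpen_ball.measurableSet, setLIntegral_const, mul_comm]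
  have h2 : ∀ z, ∫⁻ x, S.indicator (fun q => f q.1) (x, z) ∂μ ≤ K.indicator (fun _ => Q) z := by
    intro z
    have hle : ∫⁻ x, S.indicator (fun q => f q.1) (x, z) ∂μ ≤
        ∫⁻ x in Metric.ball z (2 * κ * depth K z), f x ∂μ := by
      rw [← lintegral_indicator Metric.isOpen_ball.measurableSet]
      refine lintegral_mono fun x => ?_
      by_cases hx : (x, z) ∈ S
      · have hx' : dist z x < κ * depth K x := hx
        have hr := depth_le_add_dist K x z
        have hr0 := depth_nonneg K x
        rw [dist_comm x z] at hr
        have hκ0 : 0 < κ := by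
          by_contra hneg
          have := mul_nonpos_of_nonpos_of_nonneg (not_lt.1 hneg) hr0
          exact absurd (dist_nonneg.trans_lt hx') (not_lt.2 this)
        have hxb : x ∈ Metric.ball z (2 * κ * depth K z) := by
          rw [Metric.mem_ball, dist_comm]
          have h3 : κ * depth K x ≤ 1 / 2 * depth K x := mul_le_mul_of_nonneg_right hκ hr0
          have h4 : depth K x ≤ 2 * depth K z := by linarith
          calc dist z x < κ * depth K x := hx'
            _ ≤ κ * (2 * depth K z) := by gcongr
            _ = _ := by ring
        rw [Set.indicator_of_mem hx, Set.indicator_of_mem hxb]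
      · rw [Set.indicator_of_notMem hx]
        exact zero_le
    by_cases hz : z ∈ K
    · rw [Set.indicator_of_mem hz]
      exact hle.trans (hQ z hz)
    · refine hle.trans ?_
      simp [depth_of_notMem hz]
  simp_rw [h1]
  rw [lintegral_lintegral_swap (f := fun x z => S.indicator (fun q => f q.1) (x, z))
    hm.aemeasurable, ← setLIntegral_const, ← lintegral_indicator hK]
  exact lintegral_mono h2

end Depth

section BoundaryDecay

variable {E F : Type*} [NormedAddCommGroup E] [NormedSpace ℝ E] [NormedAddCommGroup F]
  [NormedSpace ℝ F]

theorem norm_iteratedFDeriv_le_mul_depth_pow [FiniteDimensional ℝ E] [Nontrivial E] {f : E → F}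
    (hf : ContDiff ℝ ∞ f) (hfs : HasCompactSupport f) {n : ℕ} {N : ℝ}
    (hN : ∀ j ≤ n, ∀ x, ‖iteratedFDeriv ℝ j f x‖ ≤ N) {k : ℕ} (hk : k ≤ n) (x : E) :
    ‖iteratedFDeriv ℝ (n - k) f x‖ ≤ N * depth (tsupport f) x ^ k := by
  rcases le_total 1 (Metric.infDist x (tsupport f)ᶜ) with h | h
  · rw [depth, min_eq_left h, one_pow, mul_one]
    exact hN _ (Nat.sub_le _ _) x
  · rw [depth, min_eq_right h]
    have : ProperSpace E := FiniteDimensional.proper ℝ E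
    have : NoncompactSpace E := NormedSpace.noncompactSpace ℝ E
    have hne : (tsupport f)ᶜ.Nonempty := by
      rw [Set.nonempty_compl]
      intro hu
      exact noncompact_univ E (hu ▸ hfs.isCompact)
    obtain ⟨y, hy, hxy⟩ := isClosed_closure.exists_infDist_eq_dist hne.closure x
    rw [Metric.infDist_closure] at hxy
    rw [hxy]
    refine norm_iteratedFDeriv_le_mul_dist_pow hf (hN n le_rfl) (fun j => ?_) hk x
    have hcl : IsClosed {z | iteratedFDeriv ℝ j f z = 0} :=
      isClosed_eq (hf.continuous_iteratedFDeriv (natCast_le_infty j)) continuous_const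
    refine closure_minimal (fun z hz => ?_) hcl hy
    exact image_eq_zero_of_notMem_tsupport
      fun hz' => hz (tsupport_iteratedFDeriv_subset j hz')

theorem scaledBound_of_hasCompactSupport [FiniteDimensional ℝ E] [Nontrivial E] {f : E → F}
    (hf : ContDiff ℝ ∞ f) (hfs : HasCompactSupport f) {n : ℕ} {N : ℝ}
    (hN : ∀ j ≤ n, ∀ x, ‖iteratedFDeriv ℝ j f x‖ ≤ N) {h : ℝ} (hh : 0 ≤ h) (x : E) :
    ScaledBound h n (N * (h ^ n + depth (tsupport f) x ^ n)) f x := by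
  intro j hj
  have hN0 : 0 ≤ N := (norm_nonneg _).trans (hN 0 (Nat.zero_le _) x)
  have h1 := norm_iteratedFDeriv_le_mul_depth_pow hf hfs hN (Nat.sub_le n j) x
  rw [Nat.sub_sub_self hj] at h1
  set r := depth (tsupport f) x
  have hr : 0 ≤ r := depth_nonneg _ _
  have h2 : h ^ j * r ^ (n - j) ≤ h ^ n + r ^ n := by
    rcases le_total h r with hl | hl
    · calc h ^ j * r ^ (n - j) ≤ r ^ j * r ^ (n - j) := by gcongr
        _ = r ^ n := pow_mul_pow_sub r hj
        _ ≤ _ := le_add_of_nonneg_left (by positivity)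
    · calc h ^ j * r ^ (n - j) ≤ h ^ j * h ^ (n - j) := by gcongr
        _ = h ^ n := pow_mul_pow_sub h hj
        _ ≤ _ := le_add_of_nonneg_right (by positivity)
  calc h ^ j * ‖iteratedFDeriv ℝ j f x‖ ≤ h ^ j * (N * r ^ (n - j)) := by gcongr
    _ = N * (h ^ j * r ^ (n - j)) := by ring
    _ ≤ _ := by gcongr

end BoundaryDecay

section GradientMap

variable {d : ℕ}

/-- The gradient of `f` in coordinates. -/
noncomputable def gradMap (f : EuclideanSpace ℝ (Fin d) → ℝ) (x : EuclideanSpace ℝ (Fin d)) :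
    EuclideanSpace ℝ (Fin d) :=
  WithLp.toLp 2 fun i => partialDeriv i f x

variable {f : EuclideanSpace ℝ (Fin d) → ℝ} {a : ℝ}

theorem contDiff_gradMap (hf : ContDiff ℝ ∞ f) : ContDiff ℝ ∞ (gradMap f) :=
  contDiff_euclidean.2 fun i => contDiff_partialDeriv hf i

theorem fderiv_gradMap_apply (hf : ContDiff ℝ ∞ f) (x u : EuclideanSpace ℝ (Fin d)) (i : Fin d) :
    fderiv ℝ (gradMap f) x u i = fderiv ℝ (partialDeriv i f) x u := by
  have h1 := (EuclideanSpace.proj i : EuclideanSpace ℝ (Fin d) →L[ℝ] ℝ).hasFDerivAt.comp x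
    ((contDiff_gradMap hf).differentiable (by simp) x).hasFDerivAt
  have h2 : (EuclideanSpace.proj i : EuclideanSpace ℝ (Fin d) →L[ℝ] ℝ) ∘ gradMap f =
      partialDeriv i f := rfl
  rw [← h2, h1.fderiv]
  rfl

theorem fderiv_partialDeriv_apply (x u : EuclideanSpace ℝ (Fin d)) (i : Fin d) :
    fderiv ℝ (partialDeriv i f) x u = Matrix.vecMul u (hess f x) i := by
  have hu : u = ∑ j, u j • EuclideanSpace.single j (1 : ℝ) := by
    ext j
    simp [Finset.sum_apply, Pi.single_apply]
  conv_lhs => rw [hu, map_sum]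
  simp [Matrix.vecMul, dotProduct, hess, partialDeriv]

theorem det_fderiv_gradMap (hf : ContDiff ℝ ∞ f) (x : EuclideanSpace ℝ (Fin d)) :
    (fderiv ℝ (gradMap f) x).det = (hess f x).det := by
  have : LinearMap.toMatrix (EuclideanSpace.basisFun (Fin d) ℝ).toBasis
      (EuclideanSpace.basisFun (Fin d) ℝ).toBasis
      (fderiv ℝ (gradMap f) x : EuclideanSpace ℝ (Fin d) →ₗ[ℝ] EuclideanSpace ℝ (Fin d)) =
      (hess f x).transpose := by
    ext i j
    rw [LinearMap.toMatrix_apply]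
    simp only [OrthonormalBasis.coe_toBasis, EuclideanSpace.basisFun_apply,
      OrthonormalBasis.coe_toBasis_repr_apply, EuclideanSpace.basisFun_repr,
      ContinuousLinearMap.coe_coe, Matrix.transpose_apply]
    rw [fderiv_gradMap_apply hf]
    rfl
  rw [ContinuousLinearMap.det, ← LinearMap.det_toMatrix (EuclideanSpace.basisFun (Fin d) ℝ).toBasis,
    this, Matrix.det_transpose]

theorem abs_hess_le (hf : ContDiff ℝ ∞ f) (x : EuclideanSpace ℝ (Fin d)) (i j : Fin d) :
    |hess f x i j| ≤ ‖iteratedFDeriv ℝ 2 f x‖ := by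
  have h1 := iteratedFDeriv_single_eq_listDeriv hf 2 ![i, j] x
  have h2 : hess f x i j = iteratedFDeriv ℝ 2 f x
      fun k => EuclideanSpace.single (![i, j] k) (1 : ℝ) := by
    rw [h1]
    simp [listDeriv, hess]
  rw [h2, ← Real.norm_eq_abs]
  refine ((iteratedFDeriv ℝ 2 f x).le_opNorm _).trans (le_of_eq ?_)
  simp

theorem abs_det_hess_le (hf : ContDiff ℝ ∞ f) {x : EuclideanSpace ℝ (Fin d)}
    (h2 : ‖iteratedFDeriv ℝ 2 f x‖ ≤ 1) : |(hess f x).det| ≤ d.factorial := by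
  have := Matrix.det_le (A := hess f x) (abv := AbsoluteValue.abs) (x := 1)
    fun i j => (abs_hess_le hf x i j).trans h2
  simpa using this

theorem abs_adjugate_le {A : Matrix (Fin d) (Fin d) ℝ} (hA : ∀ i j, |A i j| ≤ 1) (i j : Fin d) :
    |A.adjugate i j| ≤ d.factorial := by
  rw [Matrix.adjugate_apply]
  have := Matrix.det_le (A := A.updateRow j (Pi.single i 1)) (abv := AbsoluteValue.abs) (x := 1)
    fun k l => by
      rw [AbsoluteValue.abs_apply, Matrix.updateRow_apply]
      split_ifs
      · rw [Pi.single_apply]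
        split_ifs <;> simp
      · exact hA k l
  simpa using this

theorem abs_det_mul_norm_le {A : Matrix (Fin d) (Fin d) ℝ} (hA : ∀ i j, |A i j| ≤ 1)
    {u : EuclideanSpace ℝ (Fin d)} {ε : ℝ} (hu : ∀ i, |Matrix.vecMul u A i| ≤ ε) :
    |A.det| * ‖u‖ ≤ (d : ℝ) ^ 2 * d.factorial * ε := by
  have hcoord : ∀ j, |A.det| * |u j| ≤ d * (d.factorial * ε) := by
    intro j
    have h1 : A.det * u j = ∑ i, Matrix.vecMul u A i * A.adjugate i j := by
      have : Matrix.vecMul (Matrix.vecMul u A) A.adjugate = A.det • (u : Fin d → ℝ) := by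
        rw [Matrix.vecMul_vecMul, Matrix.mul_adjugate, Matrix.vecMul_smul, Matrix.vecMul_one]
      have := congrFun this j
      simp only [Pi.smul_apply, smul_eq_mul] at this
      rw [← this]
      rfl
    rw [← abs_mul, h1]
    refine (Finset.abs_sum_le_sum_abs _ _).trans ?_
    calc ∑ i, |Matrix.vecMul u A i * A.adjugate i j| ≤ ∑ _i : Fin d, (d.factorial : ℝ) * ε := by
          refine Finset.sum_le_sum fun i _ => ?_
          rw [abs_mul, mul_comm]
          exact mul_le_mul (abs_adjugate_le hA i j) (hu i) (abs_nonneg _) (by positivity)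
      _ = _ := by simp
  have hnorm : ‖u‖ ≤ ∑ j, |u j| := by
    have hu : u = ∑ j, u j • EuclideanSpace.single j (1 : ℝ) := by
      ext j
      simp [Finset.sum_apply, Pi.single_apply]
    conv_lhs => rw [hu]
    refine (norm_sum_le _ _).trans (le_of_eq ?_)
    simp [norm_smul]
  calc |A.det| * ‖u‖ ≤ |A.det| * ∑ j, |u j| := by gcongr
    _ = ∑ j, |A.det| * |u j| := Finset.mul_sum _ _ _
    _ ≤ ∑ _j : Fin d, (d : ℝ) * (d.factorial * ε) := Finset.sum_le_sum fun j _ => hcoord j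
    _ = _ := by simp; ring

theorem injOn_gradMap (hf : ContDiff ℝ ∞ f) {z : EuclideanSpace ℝ (Fin d)} {s : ℝ}
    (h2 : ‖iteratedFDeriv ℝ 2 f z‖ ≤ 1)
    (h3 : ∀ x ∈ Metric.ball z s, ‖iteratedFDeriv ℝ 3 f x‖ ≤ 1)
    (hs : (d : ℝ) ^ 2 * d.factorial * s < |(hess f z).det|) :
    Set.InjOn (gradMap f) (Metric.ball z s) := by
  intro x hx y hy hxy
  have hs0 : 0 < s := dist_nonneg.trans_lt (Metric.mem_ball.1 hx)
  by_contra hne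
  have hpos : 0 < ‖x - y‖ := norm_pos_iff.2 (sub_ne_zero.2 hne)
  have hA : ∀ i j, |hess f z i j| ≤ 1 := fun i j => (abs_hess_le hf z i j).trans h2
  have hu : ∀ i, |Matrix.vecMul (x - y) (hess f z) i| ≤ s * ‖x - y‖ := by
    intro i
    have hgc := contDiff_partialDeriv hf i
    have hdd : Differentiable ℝ (fderiv ℝ (partialDeriv i f)) :=
      (hgc.fderiv_right (m := 1) (by norm_cast)).differentiable (by simp)
    have hD2 : ∀ w ∈ Metric.ball z s, ‖fderiv ℝ (fderiv ℝ (partialDeriv i f)) w‖ ≤ 1 := by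
      intro w hw
      rw [← norm_iteratedFDeriv_one, norm_iteratedFDeriv_fderiv]
      have := pow_mul_norm_iteratedFDeriv_fderiv_apply_le (h := 1) (x := w) zero_le_one hf
        (e := EuclideanSpace.single i (1 : ℝ)) (by simp) 2
      simp only [one_pow, one_mul, one_smul] at this
      exact this.trans (h3 w hw)
    have hlip : ∀ w ∈ Metric.ball z s,
        ‖fderiv ℝ (partialDeriv i f) w - fderiv ℝ (partialDeriv i f) z‖ ≤ s := by
      intro w hw
      have := (convex_ball z s).norm_image_sub_le_of_norm_fderiv_le (𝕜 := ℝ)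
        (fun w _ => hdd w) hD2 (Metric.mem_ball_self hs0) hw
      rw [one_mul, ← dist_eq_norm w z] at this
      exact this.trans (Metric.mem_ball.1 hw).le
    have := (convex_ball z s).norm_image_sub_le_of_norm_fderiv_le' (𝕜 := ℝ)
      (fun w _ => (hgc.differentiable (by simp)) w) hlip hy hx
    have heq : partialDeriv i f x = partialDeriv i f y := congrArg (fun v => v i) hxy
    rw [heq, sub_self, zero_sub, norm_neg, fderiv_partialDeriv_apply] at this
    exact this
  have := abs_det_mul_norm_le hA hu
  nlinarith

open MeasureTheory in
theorem mul_lintegral_comp_gradMap_le (hf : ContDiff ℝ ∞ f)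
    {s : Set (EuclideanSpace ℝ (Fin d))} (hs : MeasurableSet s) (hinj : Set.InjOn (gradMap f) s)
    (ha : ∀ x ∈ s, a ≤ |(hess f x).det|) (F : EuclideanSpace ℝ (Fin d) → ℝ≥0∞) :
    ENNReal.ofReal a * ∫⁻ x in s, F (gradMap f x) ≤ ∫⁻ y, F y := by
  refine le_trans ?_ (setLIntegral_le_lintegral (gradMap f '' s) F)
  rw [lintegral_image_eq_lintegral_abs_det_fderiv_mul volume hs
    (fun x _ => ((contDiff_gradMap hf).differentiable (by simp) x).hasFDerivAt.hasFDerivWithinAt)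
    hinj F, ← lintegral_const_mul' _ _ ENNReal.ofReal_ne_top]
  refine setLIntegral_mono' hs fun x hx => ?_
  rw [det_fderiv_gradMap hf]
  gcongr
  exact ha x hx

end GradientMap

section StationaryPhaseEstimate

open MeasureTheory

variable {d : ℕ}

theorem lintegral_depth_pow_mul_comp_gradMap_le (hd : 1 ≤ d)
    {f : EuclideanSpace ℝ (Fin d) → ℝ} (hf : ContDiff ℝ ∞ f)
    {K : Set (EuclideanSpace ℝ (Fin d))} (hK : MeasurableSet K) (hne : K.Nonempty)
    (h2 : ∀ x ∈ K, ‖iteratedFDeriv ℝ 2 f x‖ ≤ 1) (h3 : ∀ x ∈ K, ‖iteratedFDeriv ℝ 3 f x‖ ≤ 1)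
    {a : ℝ} (ha : 0 < a) (hdet : ∀ x ∈ K, a ≤ |(hess f x).det|)
    {F : EuclideanSpace ℝ (Fin d) → ℝ≥0∞} (hF : Measurable F) :
    ENNReal.ofReal ((a / (4 * ((d : ℝ) ^ 2 * d.factorial))) ^ d) *
        volume (Metric.ball (0 : EuclideanSpace ℝ (Fin d)) 1) *
        ∫⁻ x in K, ENNReal.ofReal (depth K x ^ d) * F (gradMap f x) ≤
      (ENNReal.ofReal a)⁻¹ * (∫⁻ y, F y) * volume K := by
  have hd1 : (1 : ℝ) ≤ (d : ℝ) ^ 2 := one_le_pow₀ (by exact_mod_cast hd)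
  have hfac : (0 : ℝ) < d.factorial := by exact_mod_cast d.factorial_pos
  set q : ℝ := (d : ℝ) ^ 2 * d.factorial with hq
  have hq0 : 0 < q := by positivity
  set κ : ℝ := a / (4 * q) with hκ
  have hκ0 : 0 < κ := by positivity
  have hκq : q * (2 * κ) = a / 2 := by rw [hκ]; field_simp; norm_num
  obtain ⟨x₀, hx₀⟩ := hne
  have haq : a ≤ q := by
    refine ((hdet x₀ hx₀).trans (abs_det_hess_le hf (h2 x₀ hx₀))).trans ?_
    exact le_mul_of_one_le_left hfac.le hd1
  have hκ4 : κ ≤ 1 / 4 := by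
    rw [hκ, div_le_div_iff₀ (by positivity) (by norm_num)]
    linarith
  have : Nontrivial (EuclideanSpace ℝ (Fin d)) := by
    have : Nonempty (Fin d) := ⟨⟨0, hd⟩⟩
    infer_instance
  have hQ : ∀ z ∈ K, ∫⁻ x in Metric.ball z (2 * κ * depth K z), F (gradMap f x) ≤
      (ENNReal.ofReal a)⁻¹ * ∫⁻ y, F y := by
    intro z hz
    have hr0 := depth_nonneg K z
    have hr1 := depth_le_one K z
    have hsub : Metric.ball z (2 * κ * depth K z) ⊆ K := by
      refine (Metric.ball_subset_ball ?_).trans (ball_depth_subset K z)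
      exact mul_le_of_le_one_left hr0 (by linarith)
    have hinj : Set.InjOn (gradMap f) (Metric.ball z (2 * κ * depth K z)) := by
      refine injOn_gradMap hf (h2 z hz) (fun x hx => h3 x (hsub hx)) ?_
      refine lt_of_lt_of_le ?_ (hdet z hz)
      calc q * (2 * κ * depth K z) = a / 2 * depth K z := by rw [← mul_assoc, hκq]
        _ ≤ a / 2 := mul_le_of_le_one_right (by positivity) hr1
        _ < a := by linarith
    rw [← ENNReal.mul_le_iff_le_inv (by simpa using ha) ENNReal.ofReal_ne_top]
    exact mul_lintegral_comp_gradMap_le hf Metric.isOpen_ball.measurableSet hinj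
      (fun x hx => hdet x (hsub hx)) F
  have hFm : Measurable fun x => F (gradMap f x) :=
    hF.comp (contDiff_gradMap hf).continuous.measurable
  refine le_trans ?_ (lintegral_measure_ball_mul_le volume hK (by linarith : κ ≤ 1 / 2) hFm hQ)
  refine le_trans (le_of_eq ?_) (setLIntegral_le_lintegral K _)
  have hm : Measurable fun x => ENNReal.ofReal (depth K x ^ d) * F (gradMap f x) :=
    (ENNReal.measurable_ofReal.comp ((continuous_depth K).pow d).measurable).mul hFm
  rw [← lintegral_const_mul _ hm]
  refine lintegral_congr fun x => ?_
  rw [Measure.addHaar_ball volume x (mul_nonneg hκ0.le (depth_nonneg K x)), finrank_euclideanSpace,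
    Fintype.card_fin, mul_pow, ENNReal.ofReal_mul (by positivity)]
  ring

theorem lintegral_comp_inv_smul {h : ℝ} (hh : 0 < h)
    {F : EuclideanSpace ℝ (Fin d) → ℝ≥0∞} (hF : Measurable F) :
    ∫⁻ y, F (h⁻¹ • y) = ENNReal.ofReal (h ^ d) * ∫⁻ y, F y := by
  rw [← lintegral_map (μ := volume) hF (measurable_const_smul h⁻¹),
    Measure.map_addHaar_smul volume (inv_ne_zero hh.ne'), lintegral_smul_measure,
    finrank_euclideanSpace, Fintype.card_fin, inv_pow, inv_inv, abs_of_pos (by positivity)]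
  rfl

theorem lintegral_inv_sqrt_one_add_norm_sq_lt_top :
    ∫⁻ y : EuclideanSpace ℝ (Fin d), ENNReal.ofReal (((√(1 + ‖y‖ ^ 2))⁻¹) ^ (d + 1)) < ⊤ := by
  have hint := integrable_rpow_neg_one_add_norm_sq (E := EuclideanSpace ℝ (Fin d))
    (μ := volume) (r := (d : ℝ) + 1) (by rw [finrank_euclideanSpace, Fintype.card_fin]; linarith)
  have heq : ∀ y : EuclideanSpace ℝ (Fin d), ((√(1 + ‖y‖ ^ 2))⁻¹) ^ (d + 1) =
      (1 + ‖y‖ ^ 2) ^ (-((d : ℝ) + 1) / 2) := by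
    intro y
    have hp : (0 : ℝ) ≤ 1 + ‖y‖ ^ 2 := by positivity
    rw [Real.sqrt_eq_rpow, ← Real.rpow_neg hp, ← Real.rpow_mul_natCast hp]
    congr 1
    push_cast
    ring
  simp_rw [heq]
  exact hint.lintegral_lt_top

theorem partialDeriv_const_smul {F : Type*} [NormedAddCommGroup F] [NormedSpace ℝ F] (c : ℝ)
    {f : EuclideanSpace ℝ (Fin d) → F} (hf : ContDiff ℝ ∞ f) (i : Fin d) :
    partialDeriv i (fun y => c • f y) = fun y => c • partialDeriv i f y := by
  funext x
  unfold partialDeriv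
  rw [fderiv_fun_const_smul (hf.differentiable (by simp) x)]
  rfl

theorem hess_const_smul (c : ℝ) {f : EuclideanSpace ℝ (Fin d) → ℝ} (hf : ContDiff ℝ ∞ f)
    (x : EuclideanSpace ℝ (Fin d)) : hess (fun y => c • f y) x = c • hess f x := by
  ext i j
  simp only [hess, Matrix.of_apply, Matrix.smul_apply]
  rw [partialDeriv_const_smul c hf, partialDeriv_const_smul c (contDiff_partialDeriv hf j)]

theorem gradWeight_inv_sq_smul {h : ℝ} (hh : h ≠ 0) {f : EuclideanSpace ℝ (Fin d) → ℝ}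
    (hf : ContDiff ℝ ∞ f) (x : EuclideanSpace ℝ (Fin d)) :
    gradWeight h (fun y => (h ^ 2)⁻¹ • f y) x = 1 + ‖h⁻¹ • gradMap f x‖ ^ 2 := by
  rw [EuclideanSpace.norm_sq_eq, gradWeight]
  congr 1
  refine Finset.sum_congr rfl fun m _ => ?_
  have key : rescaledPartial h (fun y => (h ^ 2)⁻¹ • f y) m x = h⁻¹ * partialDeriv m f x := by
    rw [rescaledPartial, partialDeriv_const_smul _ hf]
    simp only [smul_eq_mul]
    field_simp
  rw [key, Real.norm_eq_abs, sq_abs, sq]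
  rfl

theorem norm_integral_exp_mul_le_of_normalized (hd : 1 ≤ d) (v : ℝ≥0) :
    ∃ C : ℝ, 0 ≤ C ∧ ∀ (f : EuclideanSpace ℝ (Fin d) → ℝ) (b : EuclideanSpace ℝ (Fin d) → ℂ)
      (a N h : ℝ), ContDiff ℝ ∞ f → ContDiff ℝ ∞ b → HasCompactSupport b →
      volume (tsupport b) ≤ (v : ℝ≥0∞) → 0 < a → 0 < h → h ≤ 1 →
      (∀ x ∈ tsupport b, ∀ j, 2 ≤ j → j ≤ d + 2 → ‖iteratedFDeriv ℝ j f x‖ ≤ 1) →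
      (∀ j ≤ d + 1, ∀ x, ‖iteratedFDeriv ℝ j b x‖ ≤ N) →
      (∀ x ∈ tsupport b, a ≤ |(hess f x).det|) →
      ‖∫ x, Complex.exp (Complex.I * (((h ^ 2)⁻¹ • f x : ℝ) : ℂ)) * b x‖ ≤
        C / a ^ (1 + d) * N * h ^ d := by
  set T : ℝ := transposeConst d (d + 1) with hT
  have hT0 : 0 ≤ T := transposeConst_nonneg _ _
  set β : ℝ := (volume (Metric.ball (0 : EuclideanSpace ℝ (Fin d)) 1)).toReal with hβ
  have hβ' : volume (Metric.ball (0 : EuclideanSpace ℝ (Fin d)) 1) = ENNReal.ofReal β :=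
    (ENNReal.ofReal_toReal measure_ball_lt_top.ne).symm
  have hβ0 : 0 < β :=
    ENNReal.toReal_pos (Metric.measure_ball_pos _ _ one_pos).ne' measure_ball_lt_top.ne
  set W : EuclideanSpace ℝ (Fin d) → ℝ := fun y => ((√(1 + ‖y‖ ^ 2))⁻¹) ^ (d + 1) with hW
  have hW0 : ∀ y, 0 ≤ W y := fun y => by positivity
  have hW1 : ∀ y, W y ≤ 1 := fun y => by
    refine pow_le_one₀ (by positivity) (inv_le_one_of_one_le₀ (Real.one_le_sqrt.2 ?_))
    exact le_add_of_nonneg_right (by positivity)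
  have hWm : Measurable fun y => ENNReal.ofReal (W y) := by fun_prop
  set J : ℝ := (∫⁻ y, ENNReal.ofReal (W y)).toReal with hJ
  have hJ' : ∫⁻ y, ENNReal.ofReal (W y) = ENNReal.ofReal J :=
    (ENNReal.ofReal_toReal lintegral_inv_sqrt_one_add_norm_sq_lt_top.ne).symm
  have hJ0 : 0 ≤ J := ENNReal.toReal_nonneg
  have hd0 : (0 : ℝ) < d := by exact_mod_cast hd
  have hfac : (0 : ℝ) < d.factorial := by exact_mod_cast d.factorial_pos
  set q : ℝ := 4 * ((d : ℝ) ^ 2 * d.factorial) with hq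
  have hq0 : 0 < q := by positivity
  refine ⟨T ^ (d + 1) * v * ((d.factorial : ℝ) ^ (1 + d) + q ^ d * J / β), by positivity, ?_⟩
  intro f b a N h hf hb hbs hv ha hh hh1 hfb hbN hdet
  have hN0 : 0 ≤ N := (norm_nonneg _).trans (hbN 0 (Nat.zero_le _) 0)
  rcases (tsupport b).eq_empty_or_nonempty with hK | hne
  · rw [tsupport_eq_empty_iff] at hK
    simp only [hK, Pi.zero_apply, mul_zero, integral_zero, norm_zero]
    positivity
  have : Nontrivial (EuclideanSpace ℝ (Fin d)) := by
    have : Nonempty (Fin d) := ⟨⟨0, hd⟩⟩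
    infer_instance
  set K := tsupport b with hKdef
  have hKm : MeasurableSet K := (isClosed_tsupport b).measurableSet
  have hafac : a ≤ d.factorial := by
    obtain ⟨x₀, hx₀⟩ := hne
    exact (hdet x₀ hx₀).trans (abs_det_hess_le hf (hfb x₀ hx₀ 2 le_rfl (by omega)))
  have hθ : ContDiff ℝ ∞ fun y => (h ^ 2)⁻¹ • f y := hf.const_smul _
  have hθb : ∀ x ∈ K, ∀ j, 2 ≤ j → j ≤ d + 1 + 1 →
      h ^ j * ‖iteratedFDeriv ℝ j (fun y => (h ^ 2)⁻¹ • f y) x‖ ≤ 1 := by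
    intro x hx j hj2 hj
    rw [iteratedFDeriv_const_smul_apply' (hf.contDiffAt.of_le (natCast_le_infty j)), norm_smul,
      Real.norm_of_nonneg (by positivity), ← mul_assoc, ← pow_sub_mul_pow h hj2,
      mul_assoc (h ^ (j - 2)), mul_inv_cancel₀ (by positivity), mul_one]
    exact mul_le_one₀ (pow_le_one₀ hh.le hh1) (norm_nonneg _) (hfb x hx j hj2 hj)
  have hmain := norm_integral_exp_mul_le hθ hb hbs hh.le (d + 1) hθb
    (A := fun x => N * (h ^ (d + 1) + depth K x ^ (d + 1)))
    (fun x _ => scaledBound_of_hasCompactSupport hb hbs hbN hh.le x)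
  have hF : Measurable fun y : EuclideanSpace ℝ (Fin d) => ENNReal.ofReal (W (h⁻¹ • y)) :=
    hWm.comp (measurable_const_smul h⁻¹)
  set X := ∫⁻ x in K, ENNReal.ofReal (depth K x ^ d) * ENNReal.ofReal (W (h⁻¹ • gradMap f x))
    with hX
  have hgeo : ENNReal.ofReal ((a / q) ^ d) * ENNReal.ofReal β * X ≤
      (ENNReal.ofReal a)⁻¹ * ENNReal.ofReal (h ^ d * J) * ENNReal.ofReal v := by
    have := lintegral_depth_pow_mul_comp_gradMap_le hd hf hKm hne
      (fun x hx => hfb x hx 2 le_rfl (by omega)) (fun x hx => hfb x hx 3 (by omega) (by omega))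
      ha hdet hF
    rw [lintegral_comp_inv_smul hh hWm, hβ', hJ'] at this
    rw [ENNReal.ofReal_mul (by positivity), ENNReal.ofReal_coe_nnreal]
    refine this.trans ?_
    gcongr
  have hXle : X ≤ ENNReal.ofReal (q ^ d * J / β * v * h ^ d / a ^ (1 + d)) := by
    rw [← ENNReal.ofReal_mul (by positivity), ← ENNReal.ofReal_inv_of_pos ha,
      ← ENNReal.ofReal_mul (by positivity), ← ENNReal.ofReal_mul (by positivity),
      ENNReal.mul_le_iff_le_inv (by simp; positivity) ENNReal.ofReal_ne_top,
      ← ENNReal.ofReal_inv_of_pos (by positivity), ← ENNReal.ofReal_mul (by positivity)] at hgeo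
    refine hgeo.trans (le_of_eq (congrArg _ ?_))
    rw [div_pow, pow_add, pow_one]
    field_simp
  have hpt : ∀ x, (T * (√(gradWeight h (fun y => (h ^ 2)⁻¹ • f y) x))⁻¹) ^ (d + 1) *
      (N * (h ^ (d + 1) + depth K x ^ (d + 1))) ≤
      T ^ (d + 1) * N * h ^ d + T ^ (d + 1) * N * (depth K x ^ d * W (h⁻¹ • gradMap f x)) := by
    intro x
    rw [gradWeight_inv_sq_smul hh.ne' hf, mul_pow]
    have h1 : ((√(1 + ‖h⁻¹ • gradMap f x‖ ^ 2))⁻¹) ^ (d + 1) = W (h⁻¹ • gradMap f x) := rfl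
    rw [h1]
    have hw0 := hW0 (h⁻¹ • gradMap f x)
    have hw1 := hW1 (h⁻¹ • gradMap f x)
    have hr0 := depth_nonneg K x
    have hr : depth K x ^ (d + 1) ≤ depth K x ^ d :=
      pow_le_pow_of_le_one hr0 (depth_le_one K x) (Nat.le_succ d)
    have hhd : h ^ (d + 1) ≤ h ^ d := pow_le_pow_of_le_one hh.le hh1 (Nat.le_succ d)
    calc _ = T ^ (d + 1) * N * (W (h⁻¹ • gradMap f x) * h ^ (d + 1)) +
          T ^ (d + 1) * N * (depth K x ^ (d + 1) * W (h⁻¹ • gradMap f x)) := by ring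
      _ ≤ T ^ (d + 1) * N * (1 * h ^ d) +
          T ^ (d + 1) * N * (depth K x ^ d * W (h⁻¹ • gradMap f x)) := by gcongr
      _ = _ := by ring
  have hbound : ENNReal.ofReal
      ‖∫ x, Complex.exp (Complex.I * (((h ^ 2)⁻¹ • f x : ℝ) : ℂ)) * b x‖ ≤
      ENNReal.ofReal (T ^ (d + 1) * N * h ^ d * v +
        T ^ (d + 1) * N * (q ^ d * J / β * v * h ^ d / a ^ (1 + d))) := by
    refine hmain.trans ?_
    calc _ ≤ ∫⁻ x in K, (ENNReal.ofReal (T ^ (d + 1) * N * h ^ d) +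
          ENNReal.ofReal (T ^ (d + 1) * N) *
            (ENNReal.ofReal (depth K x ^ d) * ENNReal.ofReal (W (h⁻¹ • gradMap f x)))) := by
          refine lintegral_mono fun x => ?_
          refine (ENNReal.ofReal_le_ofReal (hpt x)).trans (le_of_eq ?_)
          have hr0 := depth_nonneg K x
          have hw0 := hW0 (h⁻¹ • gradMap f x)
          rw [ENNReal.ofReal_add (by positivity) (by positivity),
            ENNReal.ofReal_mul (q := depth K x ^ d * W (h⁻¹ • gradMap f x)) (by positivity),
            ENNReal.ofReal_mul (p := depth K x ^ d) (by positivity)]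
      _ = ENNReal.ofReal (T ^ (d + 1) * N * h ^ d) * volume K +
          ENNReal.ofReal (T ^ (d + 1) * N) * X := by
          rw [lintegral_add_left measurable_const, setLIntegral_const,
            lintegral_const_mul' _ _ ENNReal.ofReal_ne_top]
      _ ≤ ENNReal.ofReal (T ^ (d + 1) * N * h ^ d) * ENNReal.ofReal v +
          ENNReal.ofReal (T ^ (d + 1) * N) *
            ENNReal.ofReal (q ^ d * J / β * v * h ^ d / a ^ (1 + d)) := by
          rw [ENNReal.ofReal_coe_nnreal]
          gcongr
      _ = _ := by
          rw [← ENNReal.ofReal_mul (by positivity), ← ENNReal.ofReal_mul (by positivity),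
            ← ENNReal.ofReal_add (by positivity) (by positivity)]
  refine ((ENNReal.ofReal_le_ofReal_iff (by positivity)).1 hbound).trans ?_
  have hone : 1 ≤ (d.factorial : ℝ) ^ (1 + d) / a ^ (1 + d) := by
    rw [one_le_div (by positivity)]
    gcongr
  calc _ = T ^ (d + 1) * N * h ^ d * v * 1 +
        T ^ (d + 1) * N * (q ^ d * J / β * v * h ^ d / a ^ (1 + d)) := by ring
    _ ≤ T ^ (d + 1) * N * h ^ d * v * ((d.factorial : ℝ) ^ (1 + d) / a ^ (1 + d)) +
        T ^ (d + 1) * N * (q ^ d * J / β * v * h ^ d / a ^ (1 + d)) := by gcongr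
    _ = _ := by ring

theorem norm_oscIntegral_le (hd : 1 ≤ d) (v : ℝ≥0) :
    ∃ C : ℝ, 0 ≤ C ∧ ∀ (Φ : EuclideanSpace ℝ (Fin d) → ℝ) (b : EuclideanSpace ℝ (Fin d) → ℂ)
      (a M N lam : ℝ), ContDiff ℝ ∞ Φ → ContDiff ℝ ∞ b → HasCompactSupport b →
      volume (tsupport b) ≤ (v : ℝ≥0∞) → 0 < a → 1 ≤ M → 1 ≤ lam →
      (∀ x ∈ tsupport b, ∀ j, 2 ≤ j → j ≤ d + 2 → ‖iteratedFDeriv ℝ j Φ x‖ ≤ M) →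
      (∀ j ≤ d + 1, ∀ x, ‖iteratedFDeriv ℝ j b x‖ ≤ N) →
      (∀ x ∈ tsupport b, a ≤ |(hess Φ x).det|) →
      ‖oscIntegral Φ b lam‖ ≤
        C / a ^ (1 + d) * M ^ ((d : ℝ) / 2 + (d : ℝ) ^ 2) * N * lam ^ (-((d : ℝ) / 2)) := by
  obtain ⟨C, hC0, hC⟩ := norm_integral_exp_mul_le_of_normalized hd v
  refine ⟨C, hC0, ?_⟩
  intro Φ b a M N lam hΦ hb hbs hv ha hM hlam hΦM hbN hdet
  have hM0 : 0 < M := by linarith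
  have hlam0 : 0 < lam := by linarith
  have hsq : 1 ≤ √(lam * M) := Real.one_le_sqrt.2 (one_le_mul_of_one_le_of_one_le hlam hM)
  have key := hC (fun x => M⁻¹ • Φ x) b (a / M ^ d) N (√(lam * M))⁻¹ (hΦ.const_smul _) hb hbs hv
    (by positivity) (by positivity) (inv_le_one_of_one_le₀ hsq)
    (fun x hx j hj2 hj => by
      rw [iteratedFDeriv_const_smul_apply' (hΦ.contDiffAt.of_le (natCast_le_infty j)), norm_smul,
        Real.norm_of_nonneg (by positivity), inv_mul_le_iff₀ hM0, mul_one]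
      exact hΦM x hx j hj2 hj)
    hbN
    (fun x hx => by
      rw [hess_const_smul _ hΦ, Matrix.det_smul, Fintype.card_fin, abs_mul,
        abs_of_pos (by positivity), inv_pow, div_eq_inv_mul]
      gcongr
      exact hdet x hx)
  have hI : oscIntegral Φ b lam = ∫ x, Complex.exp (Complex.I *
      ((((√(lam * M))⁻¹ ^ 2)⁻¹ • M⁻¹ • Φ x : ℝ) : ℂ)) * b x := by
    unfold oscIntegral
    refine integral_congr_ae (Filter.Eventually.of_forall fun x => ?_)
    have : ((√(lam * M))⁻¹ ^ 2)⁻¹ • M⁻¹ • Φ x = lam * Φ x := by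
      rw [inv_pow, inv_inv, Real.sq_sqrt (by positivity), smul_eq_mul, smul_eq_mul]
      field_simp
    simp only [this]
    push_cast
    rw [mul_assoc]
  rw [hI]
  refine key.trans (le_of_eq ?_)
  have hh : ((√(lam * M))⁻¹) ^ d = lam ^ (-((d : ℝ) / 2)) * M ^ (-((d : ℝ) / 2)) := by
    have hp : 0 ≤ lam * M := by positivity
    rw [Real.sqrt_eq_rpow, ← Real.rpow_neg hp, ← Real.rpow_mul_natCast hp,
      show -(1 / 2 : ℝ) * d = -((d : ℝ) / 2) by ring, Real.mul_rpow hlam0.le hM0.le]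
  have hMpow : (M ^ d) ^ (1 + d) * M ^ (-((d : ℝ) / 2)) = M ^ ((d : ℝ) / 2 + (d : ℝ) ^ 2) := by
    rw [← pow_mul, ← Real.rpow_natCast, ← Real.rpow_add hM0]
    congr 1
    push_cast
    ring
  rw [hh, ← hMpow, div_pow]
  field_simp

end StationaryPhaseEstimate

end StationaryPhase

theorem mainTheorem1 (d : ℕ) (hd : 1 ≤ d) (v : ℝ≥0) :
    ∃ C : ℝ, ∀ (Φ : EuclideanSpace ℝ (Fin d) → ℝ) (b : EuclideanSpace ℝ (Fin d) → ℂ)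
      (V : Set (EuclideanSpace ℝ (Fin d))) (a₀ : ℝ),
      ContDiff ℝ ∞ Φ → ContDiff ℝ ∞ b → HasCompactSupport b →
      MeasureTheory.volume (tsupport b) ≤ (v : ℝ≥0∞) →
      IsOpen V → tsupport b ⊆ V →
      (∀ k : ℕ, 2 ≤ k → k ≤ d + 2 → StationaryPhase.phaseBound k V Φ < ⊤) →
      (∀ l : ℕ, l ≤ d + 1 → StationaryPhase.symbolBound l b < ⊤) →
      0 < a₀ → (∀ ξ ∈ V, a₀ ≤ |(StationaryPhase.hess Φ ξ).det|) →
      ∀ lam : ℝ, 1 ≤ lam →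
        ‖StationaryPhase.oscIntegral Φ b lam‖ ≤
          C / a₀ ^ (1 + d)
            * (1 + (StationaryPhase.phaseBound (d + 2) V Φ).toReal ^ ((d : ℝ) / 2 + (d : ℝ) ^ 2))
            * (StationaryPhase.symbolBound (d + 1) b).toReal
            * lam ^ (-((d : ℝ) / 2)) := by
  obtain ⟨C, hC0, hC⟩ := StationaryPhase.norm_oscIntegral_le hd v
  have hd1 : (1 : ℝ) ≤ d := by exact_mod_cast hd
  set e : ℝ := (d : ℝ) / 2 + (d : ℝ) ^ 2 with he
  have he0 : 0 ≤ e := by positivity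
  refine ⟨C * ((d : ℝ) ^ (d + 2)) ^ e * (d : ℝ) ^ (d + 1), ?_⟩
  intro Φ b V a₀ hΦ hb hbs hv _ hKV hMfin hNfin ha hdet lam hlam
  set M₀ := (StationaryPhase.phaseBound (d + 2) V Φ).toReal with hM₀
  set N₀ := (StationaryPhase.symbolBound (d + 1) b).toReal with hN₀
  have hM₀0 : 0 ≤ M₀ := ENNReal.toReal_nonneg
  have hN₀0 : 0 ≤ N₀ := ENNReal.toReal_nonneg
  have hlam0 : 0 < lam := by linarith
  have hD : (1 : ℝ) ≤ (d : ℝ) ^ (d + 2) := one_le_pow₀ hd1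
  have key := hC Φ b a₀ ((d : ℝ) ^ (d + 2) * max 1 M₀) ((d : ℝ) ^ (d + 1) * N₀) lam hΦ hb hbs hv ha
    (one_le_mul_of_one_le_of_one_le hD (le_max_left _ _)) hlam
    (fun x hx j hj2 hj => by
      refine (StationaryPhase.norm_iteratedFDeriv_le_derivSum hΦ hj2 hj
        (hMfin (d + 2) (by omega) le_rfl) (hKV hx)).trans ?_
      exact mul_le_mul (pow_le_pow_right₀ hd1 hj) (le_max_right _ _) hM₀0 (by positivity))
    (fun j hj x => by
      by_cases hx : x ∈ tsupport b
      · refine (StationaryPhase.norm_iteratedFDeriv_le_derivSum hb (Nat.zero_le j) hj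
          (hNfin (d + 1) le_rfl) hx).trans ?_
        exact mul_le_mul_of_nonneg_right (pow_le_pow_right₀ hd1 hj) hN₀0
      · rw [image_eq_zero_of_notMem_tsupport
          fun hx' => hx (tsupport_iteratedFDeriv_subset j hx'), norm_zero]
        positivity)
    (fun x hx => hdet x (hKV hx))
  refine key.trans ?_
  have hmax : (max 1 M₀) ^ e ≤ 1 + M₀ ^ e := by
    rcases le_total 1 M₀ with h | h
    · rw [max_eq_right h]
      linarith
    · rw [max_eq_left h, Real.one_rpow]
      exact le_add_of_nonneg_right (Real.rpow_nonneg hM₀0 _)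
  rw [Real.mul_rpow (by positivity) (by positivity)]
  calc _ ≤ C / a₀ ^ (1 + d) * (((d : ℝ) ^ (d + 2)) ^ e * (1 + M₀ ^ e)) *
        ((d : ℝ) ^ (d + 1) * N₀) * lam ^ (-((d : ℝ) / 2)) := by gcongr
    _ = _ := by ring
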